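/- Let $H$ be a connected and simply connected real Lie group whose Lie algebra $\mathfrak h$, with underlying vector space $V$, is $2$-step nilpotent, i.e. $[x,[y,z]]=0$ for all $x,y,z\in\mathfrak h$ (the abelian case is included). Let $\mathrm{Aff}(H)=H\rtimes\mathrm{Aut}(H)$, acting on $H$ by $(m,\alpha)\cdot n=m\,\alpha(n)$, regarded as a Lie group with Lie algebra $\mathfrak{aff}(\mathfrak h)=\mathfrak h\rtimes\mathrm{Der}(\mathfrak h)$, where the topology of $\mathrm{Aut}(H)$ comes from $\alpha\mapsto d\alpha\in\mathrm{GL}(V)$. Let $\mathrm{Aff}^0(H)$ be the identity component of $\mathrm{Aff}(H)$, let $\mathrm{Aff}(V)=V\rtimes\mathrm{GL}(V)$ be the usual affine group of the vector space $V$, and let $\psi:\mathfrak{aff}(\mathfrak h)\to\mathfrak{aff}(V)=V\rtimes\mathfrak{gl}(V)$ be given by $\psi(x,D)=(x,D+\tfrac12\mathrm{ad}_x)$. Then there is a unique morphism of Lie groups $\Psi:\mathrm{Aff}^0(H)\to\mathrm{Aff}(V)$ with differential $d\Psi=\psi$ at the identity. Every $h\in H$ has a unique logarithm $\log h\in\mathfrak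 h$ (i.e. $h=\exp(\log h)$), and on translations $\Psi(h,\mathrm{id})=(\log h,\ \mathrm{id}_V+\tfrac12\mathrm{ad}_{\log h})$. Moreover, let $G$ be a connected Lie group (for example a $1$-connected solvable one) and let $\rho:G\to\mathrm{Aff}(H)$ be a representation, i.e. a smooth group homomorphism. Then $\rho(G)\subset\mathrm{Aff}^0(H)$, and the NIL-affine action of $G$ on $H$ given by $\rho$ is simply transitive (for all $x,y\in H$ there is exactly one $g\in G$ with $\rho(g)\cdot x=y$) if and only if the affine action of $G$ on $V$ given by $\Psi\circ\rho:G\to\mathrm{Aff}(V)$ is simply transitive. -/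

import Mathlib

open scoped Manifold ContDiff

noncomputable section

/-- Smooth real Lie groups satisfy the regularity under which Mathlib defines the Lie algebra. -/
instance lieGroup_minSmoothness_three {E : Type*} [NormedAddCommGroup E] [NormedSpace ℝ E]
    {H : Type*} [TopologicalSpace H] [ChartedSpace E H] [Group H] [LieGroup 𝓘(ℝ, E) ∞ H] :
    LieGroup 𝓘(ℝ, E) (minSmoothness ℝ 3) H :=
  LieGroup.of_le (n := ∞) (by
    rw [minSmoothness_of_isRCLikeNormedField]
    exact ENat.LEInfty.out)

/-! ### The group of affine transformations of a Lie group

`H` is a real Lie group modelled on the finite-dimensional vector space `E`. Its Lie algebra `𝔥` is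
Mathlib's `GroupLieAlgebra 𝓘(ℝ, E) H` (the tangent space at `1` with the bracket of left-invariant
vector fields), whose underlying vector space is `E`. -/

section Aut

variable (E : Type*) [NormedAddCommGroup E] [NormedSpace ℝ E]
  (H : Type*) [TopologicalSpace H] [ChartedSpace E H] [Group H]

/-- The group `Aut(H)` of Lie group automorphisms: group automorphisms that are smooth together
with their inverses. -/
def LieAut : Subgroup (MulAut H) where
  carrier := {α | ContMDiff 𝓘(ℝ, E) 𝓘(ℝ, E) ∞ (fun h => α h) ∧
    ContMDiff 𝓘(ℝ, E) 𝓘(ℝ, E) ∞ (fun h => α⁻¹ h)}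
  mul_mem' := by
    rintro α β ⟨h₁, h₂⟩ ⟨k₁, k₂⟩
    refine ⟨h₁.comp k₁, ?_⟩
    have : (fun h => (α * β)⁻¹ h) = (fun h => β⁻¹ h) ∘ (fun h => α⁻¹ h) := by
      ext h; rw [mul_inv_rev]; rfl
    rw [this]
    exact k₂.comp h₂
  one_mem' := ⟨contMDiff_id, contMDiff_id⟩
  inv_mem' := by
    rintro α ⟨h₁, h₂⟩
    exact ⟨h₂, by simpa using h₁⟩

variable {E H}

/-- The differential at the identity, `α ↦ dα`, as a homomorphism into `GL(V)`. -/
def autDiff : LieAut E H →* (E →L[ℝ] E)ˣ :=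
  MonoidHom.toHomUnits
    { toFun := fun α => (mfderiv 𝓘(ℝ, E) 𝓘(ℝ, E) (fun h : H => α.1 h) 1 : E →L[ℝ] E)
      map_one' := mfderiv_id
      map_mul' := by
        intro α β
        have hα : MDifferentiableAt 𝓘(ℝ, E) 𝓘(ℝ, E) (fun h : H => α.1 h) (β.1 1) :=
          α.2.1.mdifferentiableAt (by simp)
        have hβ : MDifferentiableAt 𝓘(ℝ, E) 𝓘(ℝ, E) (fun h : H => β.1 h) 1 :=
          β.2.1.mdifferentiableAt (by simp)
        have h := mfderiv_comp (1 : H) hα hβ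
        have h1 : β.1 (1 : H) = 1 := map_one β.1
        rw [h1] at h
        exact h }

/-- The Lie group topology of `Aut(H)`: the one induced from `GL(V)` by `α ↦ dα`. -/
instance : TopologicalSpace (LieAut E H) := TopologicalSpace.induced autDiff inferInstance

instance : IsTopologicalGroup (LieAut E H) := topologicalGroup_induced autDiff

variable (E H)

/-- The group `Aff(H) = H ⋊ Aut(H)` of affine transformations of `H`. -/
abbrev NilAff : Type _ := H ⋊[(LieAut E H).subtype] (LieAut E H)

variable {E H}

/-- The action `(m, α) · n = m * α(n)` of `Aff(H)` on `H`. -/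
instance : MulAction (NilAff E H) H where
  smul a n := a.left * a.right.1 n
  one_smul n := by
    change (1 : H) * (1 : MulAut H) n = n
    simp
  mul_smul a b n := by
    change (a.left * a.right.1 b.left) * a.right.1 (b.right.1 n) =
      a.left * a.right.1 (b.left * b.right.1 n)
    simp [mul_assoc]

/-- `Aff(H)` carries the product topology of `H × Aut(H)`. -/
instance : TopologicalSpace (NilAff E H) :=
  TopologicalSpace.induced SemidirectProduct.equivProd inferInstance

theorem connectedComponent_nilAff [ConnectedSpace H] :
    connectedComponent (1 : NilAff E H) =
      {a | a.right ∈ connectedComponent (1 : LieAut E H)} := by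
  let e : NilAff E H ≃ₜ H × LieAut E H :=
    SemidirectProduct.equivProd.toHomeomorphOfIsInducing ⟨rfl⟩
  have h1 := e.image_connectedComponentIn (s := Set.univ) (x := 1) (Set.mem_univ _)
  simp only [connectedComponentIn_univ, Set.image_univ, EquivLike.range_eq_univ] at h1
  have h2 : e 1 = (1, 1) := rfl
  rw [h2, connectedComponent_prod] at h1
  have h3 : connectedComponent (1 : NilAff E H) = e ⁻¹' (e '' connectedComponent 1) :=
    (Set.preimage_image_eq _ e.injective).symm
  rw [h3, h1]
  ext a
  have h5 : e a = (a.left, a.right) := rfl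
  simp [h5]

variable (E H)

/-- `Aff⁰(H)`: the connected component of the identity of `Aff(H)`. -/
def NilAffZero [ConnectedSpace H] : Subgroup (NilAff E H) where
  carrier := connectedComponent 1
  mul_mem' := by
    rw [connectedComponent_nilAff]
    intro a b ha hb
    exact (Subgroup.connectedComponentOfOne (LieAut E H)).mul_mem ha hb
  one_mem' := mem_connectedComponent
  inv_mem' := by
    rw [connectedComponent_nilAff]
    intro a ha
    exact (Subgroup.connectedComponentOfOne (LieAut E H)).inv_mem ha

variable {E H}

theorem inl_mem_nilAffZero [ConnectedSpace H] (h : H) :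
    (SemidirectProduct.inl h : NilAff E H) ∈ NilAffZero E H := by
  change _ ∈ connectedComponent (1 : NilAff E H)
  rw [connectedComponent_nilAff]
  exact mem_connectedComponent

/-- The injection `(m, α) ↦ (m, dα)` of `Aff(H)` into the manifold `H × End(V)`. For `H` simply
connected it identifies the Lie group `Aff(H)` with an embedded submanifold, and smoothness and
velocities of maps into and out of `Aff(H)` are those of this submanifold. -/
def nilAffCoord (a : NilAff E H) : H × (E →L[ℝ] E) := (a.left, (autDiff a.right : E →L[ℝ] E))

/-- A representation `ρ : G → Aff(H)`, i.e. a group homomorphism, is smooth. -/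
def IsSmoothRep {F G : Type*} [NormedAddCommGroup F] [NormedSpace ℝ F]
    [TopologicalSpace G] [ChartedSpace F G] [Group G] (ρ : G →* NilAff E H) : Prop :=
  ContMDiff 𝓘(ℝ, F) (𝓘(ℝ, E).prod 𝓘(ℝ, E →L[ℝ] E)) ∞ (fun g => nilAffCoord (ρ g))

end Aut

/-- An action of `G` on `X` (given by `act`) is simply transitive. -/
def IsSimplyTransitive {G X : Type*} (act : G → X → X) : Prop :=
  ∀ x y : X, ∃! g : G, act g x = y

section Psi

variable {E : Type*} [NormedAddCommGroup E] [NormedSpace ℝ E] [FiniteDimensional ℝ E]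
  {H : Type*} [TopologicalSpace H] [ChartedSpace E H] [Group H]

/-- The identification `a ↦ (a 0, linear part of a)` of `Aff(V) = V ⋊ GL(V)` with an open subset
of `V × End(V)`. -/
def affCoord (a : E ≃ᵃ[ℝ] E) : E × (E →L[ℝ] E) :=
  (a 0, LinearMap.toContinuousLinearMap (a.linear : E →ₗ[ℝ] E))

/-- A map `Aff⁰(H) → Aff(V)` is smooth: locally, in the coordinates `nilAffCoord` and `affCoord`,
it is the restriction of a smooth map on an open subset of `H × End(V)`. -/
def IsSmoothOnNilAffZero [ConnectedSpace H] (Ψ : NilAffZero E H → (E ≃ᵃ[ℝ] E)) : Prop :=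
  ∀ a : NilAffZero E H, ∃ U : Set (H × (E →L[ℝ] E)), IsOpen U ∧ nilAffCoord a.1 ∈ U ∧
    ∃ F : H × (E →L[ℝ] E) → E × (E →L[ℝ] E),
      ContMDiffOn (𝓘(ℝ, E).prod 𝓘(ℝ, E →L[ℝ] E)) 𝓘(ℝ, E × (E →L[ℝ] E)) ∞ F U ∧
      ∀ b : NilAffZero E H, nilAffCoord b.1 ∈ U → affCoord (Ψ b) = F (nilAffCoord b.1)

variable [LieGroup 𝓘(ℝ, E) ∞ H]

/-- The map `ψ : 𝔞𝔣𝔣(𝔥) = 𝔥 ⋊ Der(𝔥) → 𝔞𝔣𝔣(V) = V ⋊ 𝔤𝔩(V)`, `ψ(x, D) = (x, D + ½ ad_x)`. -/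
def psi (x : GroupLieAlgebra 𝓘(ℝ, E) H)
    (D : LieDerivation ℝ (GroupLieAlgebra 𝓘(ℝ, E) H) (GroupLieAlgebra 𝓘(ℝ, E) H)) :
    E × (E →ₗ[ℝ] E) :=
  (x, (D.toLinearMap + (1 / 2 : ℝ) • LieAlgebra.ad ℝ (GroupLieAlgebra 𝓘(ℝ, E) H) x :
    GroupLieAlgebra 𝓘(ℝ, E) H →ₗ[ℝ] GroupLieAlgebra 𝓘(ℝ, E) H))

/-- The curve `γ` in `Aff⁰(H)` has velocity `(x, D) ∈ 𝔥 ⋊ Der(𝔥)` at time `0`. -/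
def HasNilAffVelocity [ConnectedSpace H] (γ : ℝ → NilAffZero E H)
    (x : GroupLieAlgebra 𝓘(ℝ, E) H)
    (D : LieDerivation ℝ (GroupLieAlgebra 𝓘(ℝ, E) H) (GroupLieAlgebra 𝓘(ℝ, E) H)) : Prop :=
  HasMFDerivAt 𝓘(ℝ, ℝ) 𝓘(ℝ, E) (fun t => (γ t).1.left) 0
      (ContinuousLinearMap.toSpanSingleton ℝ (x : E) : ℝ →L[ℝ] E) ∧
    HasDerivAt (fun t => (nilAffCoord (γ t).1).2)
      (LinearMap.toContinuousLinearMap (D.toLinearMap : E →ₗ[ℝ] E)) 0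

/-- The curve `c` in `Aff(V)` has velocity `(x, D) ∈ V ⋊ 𝔤𝔩(V)` at time `0`. -/
def HasAffVelocity (c : ℝ → (E ≃ᵃ[ℝ] E)) (X : E × (E →ₗ[ℝ] E)) : Prop :=
  HasDerivAt (fun t => affCoord (c t)) (X.1, LinearMap.toContinuousLinearMap X.2) 0

/-- `Ψ : Aff⁰(H) → Aff(V)` is a morphism of Lie groups with differential `dΨ = ψ` at the identity:
it is smooth and sends a curve through `1` with velocity `(x, D)` to a curve with velocity
`ψ(x, D)`. -/
structure IntegratesPsi [ConnectedSpace H] (Ψ : NilAffZero E H →* (E ≃ᵃ[ℝ] E)) : Prop where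
  smooth : IsSmoothOnNilAffZero (fun a => Ψ a)
  deriv_eq : ∀ (γ : ℝ → NilAffZero E H) (x : GroupLieAlgebra 𝓘(ℝ, E) H)
    (D : LieDerivation ℝ (GroupLieAlgebra 𝓘(ℝ, E) H) (GroupLieAlgebra 𝓘(ℝ, E) H)),
    γ 0 = 1 → HasNilAffVelocity γ x D → HasAffVelocity (fun t => Ψ (γ t)) (psi x D)

/-- `h = exp x`: there is a one-parameter subgroup of `H` with velocity `x` at `0` that takes the
value `h` at time `1`. -/
def IsLieExp (x : GroupLieAlgebra 𝓘(ℝ, E) H) (h : H) : Prop :=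
  ∃ γ : Multiplicative ℝ →* H,
    HasMFDerivAt 𝓘(ℝ, ℝ) 𝓘(ℝ, E) (fun t : ℝ => γ (Multiplicative.ofAdd t)) 0
      (ContinuousLinearMap.toSpanSingleton ℝ (x : E) : ℝ →L[ℝ] E) ∧
    γ (Multiplicative.ofAdd 1) = h

end Psi

end

/-!
The morphism `Ψ` is conjugation by the exponential map. For a simply connected two-step nilpotent
group `exp : 𝔥 → H` is a diffeomorphism, and `exp x * exp y = exp (x + y + [x, y] / 2)`. An
automorphism `α` becomes linear in these coordinates, `α (exp v) = exp (dα v)`, and left translation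
by `exp x` becomes the affine map `v ↦ x + v + [x, v] / 2`; therefore `log ∘ a ∘ exp` is an affine
map of `V` for every `a ∈ Aff(H)`, with derivative at the identity given by `ψ`. As the action of
`Aff(H)` on `H` and its image in `Aff(V)` are conjugate by `exp`, simple transitivity of one is
that of the other. What has to be proved is thus the following.

* The product formula (`lieExp_mul_lieExp`). The bracket is computed as the antisymmetrized second
  derivative of the group law in the chart at the identity (`lie_eq_lieBr`), which makes it the
  derivative of the adjoint action (`hasFDerivAt_lieAd`). Hence `Ad (exp (t x)) y = y + t [x, y]`,
  and `t ↦ exp (t x) * exp (t y) * exp (-(t ^ 2 / 2) [x, y])` is a one-parameter subgroup with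
  velocity `x + y`.

* The exponential map is a smooth bijection with smooth inverse. Smoothness (`contMDiff_lieExp`)
  follows from the product formula, which writes `exp (∑ cᵢ vᵢ)` as a product of terms
  `exp (cᵢ vᵢ)`. By the product formula `exp` is also a homomorphism from `V` with the product
  `x + y + [x, y] / 2`; it is a local homeomorphism at the identity, hence surjective with discrete
  kernel, hence a covering map, and `H` is simply connected (`lieExp_bijective`).

* Uniqueness of `Ψ` (`IntegratesPsi.unique`). A one-parameter subgroup of `Aff(V)` is determined by
  its velocity, so `Ψ` is determined by `ψ` on the one-parameter subgroups of `Aff⁰(H)`. These cover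
  all translations, and all automorphisms near the identity: a linear automorphism of a bilinear map
  that is close to the identity is the exponential of a derivation (`eventually_exists_exp_eq`). A
  subgroup of `Aut(H)` containing a neighbourhood of `1` contains the identity component.
-/

open Filter Topology Set

/-! ### One-parameter subgroups -/

section OneParam

variable {E : Type*} [NormedAddCommGroup E] [NormedSpace ℝ E]
  {H : Type*} [TopologicalSpace H] [ChartedSpace E H]

/-- The velocity of a curve at time `t`, read in the preferred chart at the point `h = c t`. The
velocity is typed as a vector of the model space `E`. -/
theorem hasMFDerivAt_curve_iff {c : ℝ → H} {t : ℝ} {h : H} (hc : c t = h) (v : E) :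
    HasMFDerivAt 𝓘(ℝ, ℝ) 𝓘(ℝ, E) c t (ContinuousLinearMap.toSpanSingleton ℝ v : ℝ →L[ℝ] E) ↔
      ContinuousAt c t ∧ HasDerivAt (fun s => extChartAt 𝓘(ℝ, E) h (c s)) v t := by
  subst hc
  unfold HasMFDerivAt
  rw [hasDerivAt_iff_hasFDerivAt]
  simp only [modelWithCornersSelf_coe, Set.range_id]
  exact and_congr Iff.rfl hasFDerivWithinAt_univ

theorem comp_toSpanSingleton_eq {F : Type*} [NormedAddCommGroup F] [NormedSpace ℝ F]
    (A : E →L[ℝ] F) (v : E) :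
    A ∘L ContinuousLinearMap.toSpanSingleton ℝ v = ContinuousLinearMap.toSpanSingleton ℝ (A v) := by
  ext; simp

theorem comp_smulRight_one_eq {F : Type*} [NormedAddCommGroup F] [NormedSpace ℝ F]
    (A : E →L[ℝ] F) (v : E) :
    A ∘L (1 : ℝ →L[ℝ] ℝ).smulRight v = (1 : ℝ →L[ℝ] ℝ).smulRight (A v) := by
  ext; simp

variable [Group H]

variable (H) in
/-- The left-invariant vector field on `H` with value `x` at the identity. -/
noncomputable abbrev invField (x : E) (g : H) : TangentSpace 𝓘(ℝ, E) g :=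
  mulInvariantVectorField (I := 𝓘(ℝ, E)) (G := H) x g

/-- `γ` is a one-parameter subgroup of `H` with velocity `x` at `0`. -/
structure IsOneParam (x : E) (γ : ℝ → H) : Prop where
  map_add : ∀ s t, γ (s + t) = γ s * γ t
  deriv : HasMFDerivAt 𝓘(ℝ, ℝ) 𝓘(ℝ, E) γ 0
    (ContinuousLinearMap.toSpanSingleton ℝ x : ℝ →L[ℝ] E)

theorem IsOneParam.map_zero {x : E} {γ : ℝ → H} (h : IsOneParam x γ) :
    γ 0 = 1 := by
  simpa using h.map_add 0 0

theorem isLieExp_iff_isOneParam {E : Type*} [NormedAddCommGroup E] [NormedSpace ℝ E]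
    [FiniteDimensional ℝ E] {H : Type*} [TopologicalSpace H] [ChartedSpace E H] [Group H]
    [LieGroup 𝓘(ℝ, E) ∞ H] (x : GroupLieAlgebra 𝓘(ℝ, E) H) (h : H) :
    IsLieExp x h ↔ ∃ γ : ℝ → H, IsOneParam (E := E) x γ ∧ γ 1 = h := by
  constructor
  · rintro ⟨γ, h1, h2⟩
    exact ⟨fun t => γ (Multiplicative.ofAdd t), ⟨fun s t => by simp, h1⟩, h2⟩
  · rintro ⟨γ, h1, h2⟩
    exact ⟨⟨⟨fun t => γ t.toAdd, h1.map_zero⟩, fun s t => h1.map_add _ _⟩, h1.deriv, h2⟩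

theorem invField_one (x : E) :
    (invField H x (1 : H) : E) = x := by
  have : (fun h : H => 1 * h) = id := by ext; simp
  unfold invField mulInvariantVectorField
  rw [this, mfderiv_id]
  rfl

theorem IsOneParam.smul {x : E} {γ : ℝ → H} (h : IsOneParam (E := E) x γ) (a : ℝ) :
    IsOneParam (a • x) (fun t => γ (a * t)) := by
  refine ⟨fun s t => by rw [mul_add, h.map_add], ?_⟩
  obtain ⟨hc, hd⟩ := (hasMFDerivAt_curve_iff (E := E) h.map_zero x).1 h.deriv
  refine (hasMFDerivAt_curve_iff (E := E) (h := 1) (by simp [h.map_zero]) _).2 ⟨?_, ?_⟩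
  · exact ContinuousAt.comp (f := fun s => a * s) (by simpa using hc) (by fun_prop)
  · have h0 : (a * 0) = 0 := mul_zero a
    rw [← h0] at hd
    have := hd.scomp (0 : ℝ) ((hasDerivAt_id (0 : ℝ)).const_mul a)
    rw [mul_one] at this
    exact this

variable [LieGroup 𝓘(ℝ, E) ∞ H]

/-- Modelled on a normed space, a Lie group is `T1`, hence Hausdorff as a topological group. -/
theorem t2Space_of_lieGroup (E : Type*) [NormedAddCommGroup E] [NormedSpace ℝ E]
    (H : Type*) [TopologicalSpace H] [ChartedSpace E H] [Group H] [LieGroup 𝓘(ℝ, E) ∞ H] :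
    T2Space H := by
  have := topologicalGroup_of_lieGroup 𝓘(ℝ, E) ∞ (G := H)
  have := ChartedSpace.t1Space E H
  infer_instance

theorem hasMFDerivAt_mul_left_curve {c : ℝ → H} {t : ℝ} (h1 : c t = 1)
    {x : E}
    (hc : HasMFDerivAt 𝓘(ℝ, ℝ) 𝓘(ℝ, E) c t
      (ContinuousLinearMap.toSpanSingleton ℝ x : ℝ →L[ℝ] E)) (g : H) :
    HasMFDerivAt 𝓘(ℝ, ℝ) 𝓘(ℝ, E) (fun s => g * c s) t
      (ContinuousLinearMap.toSpanSingleton ℝ (invField H x g : E) : ℝ →L[ℝ] E) := by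
  have hg : ∀ p : H, p = 1 → HasMFDerivAt 𝓘(ℝ, E) 𝓘(ℝ, E) (fun h : H => g * h) p
      (mfderiv 𝓘(ℝ, E) 𝓘(ℝ, E) (fun h : H => g * h) 1 : E →L[ℝ] E) := by
    rintro _ rfl
    exact ((contMDiff_mul_left (I := 𝓘(ℝ, E)) (n := ∞) (a := g)).mdifferentiableAt
      (by simp)).hasMFDerivAt
  have h := HasMFDerivAt.comp t (hg (c t) h1) hc
  refine h.congr_mfderiv ?_
  exact comp_toSpanSingleton_eq (E := E) (F := E) _ _

/-- One-parameter subgroups are integral curves of left-invariant vector fields. -/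
theorem IsOneParam.isMIntegralCurve {x : E} {γ : ℝ → H}
    (h : IsOneParam x γ) : IsMIntegralCurve γ (invField H x) := by
  intro t
  have hs : HasMFDerivAt 𝓘(ℝ, ℝ) 𝓘(ℝ, E) (fun s => γ (s - t)) t
      (ContinuousLinearMap.toSpanSingleton ℝ x : ℝ →L[ℝ] E) := by
    obtain ⟨hc, hd⟩ := (hasMFDerivAt_curve_iff (E := E) h.map_zero x).1 h.deriv
    refine (hasMFDerivAt_curve_iff (E := E) (h := 1) (by simp [h.map_zero]) _).2
      ⟨ContinuousAt.comp (f := fun s => s - t) (by simpa using hc) (by fun_prop), ?_⟩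
    have h0 : (t - t) = 0 := sub_self t
    rw [← h0] at hd
    exact hd.comp_sub_const t t
  have := hasMFDerivAt_mul_left_curve (by simp [h.map_zero]) hs (γ t)
  have he : (fun s => γ t * γ (s - t)) = γ := by
    funext s
    rw [← h.map_add]; congr 1; ring
  rw [he] at this
  refine this.congr_mfderiv ?_
  ext
  rfl

theorem contMDiff_one_invField (x : E) :
    ContMDiff 𝓘(ℝ, E) 𝓘(ℝ, E).tangent 1
      (fun g : H => (⟨g, invField H x g⟩ : TangentBundle 𝓘(ℝ, E) H)) := by
  refine (contMDiff_mulInvariantVectorField (𝕜 := ℝ) x).of_le ?_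
  rw [minSmoothness_of_isRCLikeNormedField]
  exact one_le_two

theorem IsOneParam.unique {x : E} {γ γ' : ℝ → H}
    (h : IsOneParam x γ) (h' : IsOneParam x γ') : γ = γ' := by
  have := t2Space_of_lieGroup E H
  have : IsManifold 𝓘(ℝ, E) 1 H := IsManifold.of_le (n := ∞) (by simp)
  exact isMIntegralCurve_Ioo_eq_of_contMDiff_boundaryless (t₀ := 0)
    (contMDiff_one_invField (H := H) x) h.isMIntegralCurve h'.isMIntegralCurve
    (by rw [h.map_zero, h'.map_zero])

theorem invField_mul (x : E) (g h : H) :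
    (invField H x (g * h) : E) =
      (mfderiv 𝓘(ℝ, E) 𝓘(ℝ, E) (fun k : H => g * k) h : E →L[ℝ] E)
        (invField H x h : E) := by
  have hd : ∀ a b : H, MDifferentiableAt 𝓘(ℝ, E) 𝓘(ℝ, E) (fun k : H => a * k) b := fun a b =>
    (contMDiff_mul_left (I := 𝓘(ℝ, E)) (n := ∞) (a := a)).mdifferentiableAt (by simp)
  have hg : ∀ p : H, p = h → HasMFDerivAt 𝓘(ℝ, E) 𝓘(ℝ, E) (fun k : H => g * k) p
      (mfderiv 𝓘(ℝ, E) 𝓘(ℝ, E) (fun k : H => g * k) h : E →L[ℝ] E) := by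
    rintro _ rfl
    exact (hd _ _).hasMFDerivAt
  have hc : (fun k : H => g * h * k) = (fun k => g * k) ∘ (fun k => h * k) := by
    ext k; simp [mul_assoc]
  have h1 := (HasMFDerivAt.comp (1 : H) (hg (h * 1) (mul_one h)) (hd h 1).hasMFDerivAt).mfderiv
  rw [← hc] at h1
  exact congrArg (fun A : E →L[ℝ] E => A x) h1

/-- Left translates of integral curves of a left-invariant vector field are integral curves. -/
theorem IsMIntegralCurveOn.mul_left {x : E} {γ : ℝ → H} {s : Set ℝ}
    (h : IsMIntegralCurveOn γ (invField H x) s) (g : H) :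
    IsMIntegralCurveOn (fun t => g * γ t) (invField H x) s := by
  intro t ht
  have hg : HasMFDerivAt 𝓘(ℝ, E) 𝓘(ℝ, E) (fun h : H => g * h) (γ t) _ :=
    ((contMDiff_mul_left (I := 𝓘(ℝ, E)) (n := ∞) (a := g)).mdifferentiableAt
      (by simp)).hasMFDerivAt
  refine (HasMFDerivAt.comp_hasMFDerivWithinAt t hg (h t ht)).congr_mfderiv ?_
  refine (comp_smulRight_one_eq (E := E) (F := E) _ _).trans ?_
  exact congrArg (fun w : E => (1 : ℝ →L[ℝ] ℝ).smulRight w) (invField_mul x g (γ t)).symm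

variable [CompleteSpace E]

/-- Left-invariant vector fields are complete: left translation moves an integral curve defined on
`(-ε, ε)` to any starting point, with the same `ε`. -/
theorem exists_isOneParam (x : E) : ∃ γ : ℝ → H, IsOneParam x γ := by
  have := t2Space_of_lieGroup E H
  have : IsManifold 𝓘(ℝ, E) 1 H := IsManifold.of_le (n := ∞) (by simp)
  have hv := contMDiff_one_invField (H := H) x
  obtain ⟨c, hc0, hc⟩ := exists_isMIntegralCurveAt_of_contMDiffAt_boundaryless (x₀ := (1 : H))
    0 hv.contMDiffAt
  obtain ⟨ε, hε, hc⟩ := isMIntegralCurveAt_iff'.1 hc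
  rw [Real.ball_eq_Ioo, zero_sub, zero_add] at hc
  obtain ⟨γ, h0, hγ⟩ := exists_isMIntegralCurve_of_isMIntegralCurveOn hv hε
    (fun g => ⟨fun t => g * c t, by simp [hc0], hc.mul_left g⟩) 1
  refine ⟨γ, fun s t => ?_, ?_⟩
  · have h1 : IsMIntegralCurve (fun t => γ s * γ t) (invField H x) := by
      rw [isMIntegralCurve_iff_isMIntegralCurveOn] at hγ ⊢
      exact hγ.mul_left _
    have h2 := hγ.comp_add s
    have := isMIntegralCurve_Ioo_eq_of_contMDiff_boundaryless (t₀ := 0) hv h2 h1 (by simp [h0])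
    rw [← congrFun this t, Function.comp_apply, add_comm]
  · have h1 := hγ 0
    refine h1.congr_mfderiv ?_
    ext
    have : (invField H x (γ 0) : E) = x := by
      rw [h0, invField_one]
    simp [this]
    rfl

/-- The exponential map of the Lie group `H`: the value at time `1` of the one-parameter subgroup
with velocity `x`. -/
noncomputable def lieExp (x : E) : H :=
  (exists_isOneParam (H := H) x).choose 1

theorem IsOneParam.lieExp_eq {x : E} {γ : ℝ → H} (h : IsOneParam x γ) :
    lieExp x = γ 1 := by
  rw [h.unique (exists_isOneParam (H := H) x).choose_spec]
  rfl

theorem isOneParam_lieExp (x : E) :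
    IsOneParam x (fun t : ℝ => (lieExp (t • x) : H)) := by
  obtain ⟨γ, h⟩ := exists_isOneParam (H := H) x
  have : (fun t : ℝ => (lieExp (t • x) : H)) = γ := by
    funext t
    rw [(h.smul t).lieExp_eq, mul_one]
  rwa [this]

theorem lieExp_add_smul (s t : ℝ) (x : E) :
    lieExp (H := H) ((s + t) • x) = lieExp (s • x) * lieExp (t • x) :=
  (isOneParam_lieExp (H := H) x).map_add s t

theorem lieExp_zero : lieExp (0 : E) = (1 : H) := by
  simpa using (isOneParam_lieExp (0 : E) (H := H)).map_zero

theorem isLieExp_iff {E : Type*} [NormedAddCommGroup E] [NormedSpace ℝ E]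
    [FiniteDimensional ℝ E] [CompleteSpace E]
    {H : Type*} [TopologicalSpace H] [ChartedSpace E H] [Group H]
    [LieGroup 𝓘(ℝ, E) ∞ H] (x : GroupLieAlgebra 𝓘(ℝ, E) H) (h : H) :
    IsLieExp x h ↔ lieExp (E := E) x = h := by
  rw [isLieExp_iff_isOneParam]
  constructor
  · rintro ⟨γ, h1, rfl⟩
    exact h1.lieExp_eq
  · rintro rfl
    exact ⟨_, isOneParam_lieExp (E := E) x, congrArg lieExp (one_smul ℝ (x : E))⟩

/-- Homomorphisms of Lie groups intertwine the exponential maps. -/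
theorem map_lieExp (α : H →* H) (hα : ContMDiff 𝓘(ℝ, E) 𝓘(ℝ, E) ∞ α)
    (x : E) :
    α (lieExp x) = lieExp (E := E) ((mfderiv 𝓘(ℝ, E) 𝓘(ℝ, E) α 1 : E →L[ℝ] E) x) := by
  have h := isOneParam_lieExp (H := H) x
  have hg : ∀ p : H, p = 1 → HasMFDerivAt 𝓘(ℝ, E) 𝓘(ℝ, E) α p
      (mfderiv 𝓘(ℝ, E) 𝓘(ℝ, E) α 1 : E →L[ℝ] E) := by
    rintro _ rfl
    exact (hα.mdifferentiableAt (by simp)).hasMFDerivAt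
  have h1 : IsOneParam (E := E) ((mfderiv 𝓘(ℝ, E) 𝓘(ℝ, E) α 1 : E →L[ℝ] E) x : E)
      (fun t : ℝ => α (lieExp (t • x))) := by
    refine ⟨fun s t => by rw [lieExp_add_smul, map_mul], ?_⟩
    refine (HasMFDerivAt.comp (0 : ℝ) (hg _ h.map_zero) h.deriv).congr_mfderiv ?_
    exact comp_toSpanSingleton_eq (E := E) (F := E) _ _
  rw [h1.lieExp_eq, one_smul]

end OneParam

/-! ### The group law in the chart at the identity -/

section Chart

variable {E : Type*} [NormedAddCommGroup E] [NormedSpace ℝ E]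
  {H : Type*} [TopologicalSpace H] [ChartedSpace E H] [Group H]

variable (E H) in
/-- The chart of `H` at the identity. -/
noncomputable def idChart : PartialEquiv H E := extChartAt 𝓘(ℝ, E) (1 : H)

variable (E H) in
/-- The coordinates of the identity in the chart at the identity. -/
noncomputable def idPt : E := idChart E H 1

variable (E H) in
/-- The group law of `H`, read in the chart at the identity. -/
noncomputable def chartMul (q : E × E) : E :=
  idChart E H ((idChart E H).symm q.1 * (idChart E H).symm q.2)

theorem idPt_mem_target : idPt E H ∈ (idChart E H).target := mem_extChartAt_target 1

theorem isOpen_idChart_target : IsOpen (idChart E H).target := isOpen_extChartAt_target 1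

theorem isOpen_idChart_source : IsOpen (idChart E H).source := isOpen_extChartAt_source 1

theorem one_mem_idChart_source : (1 : H) ∈ (idChart E H).source := mem_extChartAt_source 1

theorem idChart_symm_idPt : (idChart E H).symm (idPt E H) = 1 := extChartAt_to_inv 1

theorem chartMul_left {b : E} (hb : b ∈ (idChart E H).target) :
    chartMul E H (idPt E H, b) = b := by
  simp [chartMul, idChart_symm_idPt, (idChart E H).right_inv hb]

theorem chartMul_right {a : E} (ha : a ∈ (idChart E H).target) :
    chartMul E H (a, idPt E H) = a := by
  simp [chartMul, idChart_symm_idPt, (idChart E H).right_inv ha]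

/-- The differential at the identity of the left translation by `a`, read in the chart. -/
noncomputable def chartLeft (E H : Type*) [NormedAddCommGroup E] [NormedSpace ℝ E]
    [TopologicalSpace H] [ChartedSpace E H] [Group H] (a : E) : E →L[ℝ] E :=
  fderiv ℝ (chartMul E H) (a, idPt E H) ∘L ContinuousLinearMap.inr ℝ E E

/-- The differential at the identity of the right translation by `a`, read in the chart. -/
noncomputable def chartRight (E H : Type*) [NormedAddCommGroup E] [NormedSpace ℝ E]
    [TopologicalSpace H] [ChartedSpace E H] [Group H] (a : E) : E →L[ℝ] E :=
  fderiv ℝ (chartMul E H) (idPt E H, a) ∘L ContinuousLinearMap.inl ℝ E E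

variable (E H) in
/-- The Lie bracket as a continuous bilinear map on the model space: the antisymmetrized second
derivative of the group law. -/
noncomputable def lieBr : E →L[ℝ] E →L[ℝ] E :=
  fderiv ℝ (chartLeft E H) (idPt E H) - (fderiv ℝ (chartLeft E H) (idPt E H)).flip

variable [LieGroup 𝓘(ℝ, E) ∞ H]

theorem contMDiffAt_idChart {h : H} (hh : h ∈ (idChart E H).source) :
    ContMDiffAt 𝓘(ℝ, E) 𝓘(ℝ, E) ∞ (idChart E H) h := by
  refine contMDiffAt_extChartAt' ?_
  simpa [idChart] using hh

theorem contMDiffAt_idChart_symm {a : E} (ha : a ∈ (idChart E H).target) :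
    ContMDiffAt 𝓘(ℝ, E) 𝓘(ℝ, E) ∞ (idChart E H).symm a :=
  (contMDiffOn_extChartAt_symm (1 : H)).contMDiffAt (isOpen_idChart_target.mem_nhds ha)

theorem contDiffAt_chartMul {a b : E} (ha : a ∈ (idChart E H).target)
    (hb : b ∈ (idChart E H).target)
    (hab : (idChart E H).symm a * (idChart E H).symm b ∈ (idChart E H).source) :
    ContDiffAt ℝ ∞ (chartMul E H) (a, b) := by
  rw [← contMDiffAt_iff_contDiffAt]
  have h1 : ContMDiffAt 𝓘(ℝ, E × E) 𝓘(ℝ, E) ∞ (fun q : E × E => (idChart E H).symm q.1) (a, b) :=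
    ContMDiffAt.comp (a, b) (contMDiffAt_idChart_symm ha) contDiff_fst.contMDiff.contMDiffAt
  have h2 : ContMDiffAt 𝓘(ℝ, E × E) 𝓘(ℝ, E) ∞ (fun q : E × E => (idChart E H).symm q.2) (a, b) :=
    ContMDiffAt.comp (a, b) (contMDiffAt_idChart_symm hb) contDiff_snd.contMDiff.contMDiffAt
  exact ContMDiffAt.comp (a, b) (contMDiffAt_idChart hab) (h1.mul h2)

theorem contDiffAt_chartMul_right {a : E} (ha : a ∈ (idChart E H).target) :
    ContDiffAt ℝ ∞ (chartMul E H) (a, idPt E H) :=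
  contDiffAt_chartMul ha idPt_mem_target
    (by simpa [idChart_symm_idPt] using (idChart E H).map_target ha)

theorem contDiffAt_chartMul_left {a : E} (ha : a ∈ (idChart E H).target) :
    ContDiffAt ℝ ∞ (chartMul E H) (idPt E H, a) :=
  contDiffAt_chartMul idPt_mem_target ha
    (by simpa [idChart_symm_idPt] using (idChart E H).map_target ha)

theorem hasFDerivAt_chartLeft {a : E} (ha : a ∈ (idChart E H).target) :
    HasFDerivAt (fun b => chartMul E H (a, b)) (chartLeft E H a) (idPt E H) :=
  HasFDerivAt.comp (idPt E H)
    ((contDiffAt_chartMul_right ha).differentiableAt (by simp)).hasFDerivAt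
    (hasFDerivAt_prodMk_right a (idPt E H))

theorem hasFDerivAt_chartRight {a : E} (ha : a ∈ (idChart E H).target) :
    HasFDerivAt (fun b => chartMul E H (b, a)) (chartRight E H a) (idPt E H) :=
  HasFDerivAt.comp (f := fun b => (b, a)) (idPt E H)
    ((contDiffAt_chartMul_left ha).differentiableAt (by simp)).hasFDerivAt
    (hasFDerivAt_prodMk_left (idPt E H) a)

theorem contDiffAt_chartLeft {a : E} (ha : a ∈ (idChart E H).target) :
    ContDiffAt ℝ ∞ (chartLeft E H) a := by
  have h1 : ContDiffAt ℝ ∞ (fderiv ℝ (chartMul E H)) (a, idPt E H) :=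
    (contDiffAt_chartMul_right ha).fderiv_right (by simp)
  have h2 : ContDiffAt ℝ ∞ (fun a : E => fderiv ℝ (chartMul E H) (a, idPt E H)) a :=
    ContDiffAt.comp a h1 (contDiffAt_id.prodMk contDiffAt_const)
  exact h2.clm_comp contDiffAt_const

theorem contDiffAt_chartRight {a : E} (ha : a ∈ (idChart E H).target) :
    ContDiffAt ℝ ∞ (chartRight E H) a := by
  have h1 : ContDiffAt ℝ ∞ (fderiv ℝ (chartMul E H)) (idPt E H, a) :=
    (contDiffAt_chartMul_left ha).fderiv_right (by simp)
  have h2 : ContDiffAt ℝ ∞ (fun a : E => fderiv ℝ (chartMul E H) (idPt E H, a)) a :=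
    ContDiffAt.comp a h1 (contDiffAt_const.prodMk contDiffAt_id)
  exact h2.clm_comp contDiffAt_const

theorem chartLeft_idPt : chartLeft E H (idPt E H) = ContinuousLinearMap.id ℝ E := by
  refine (hasFDerivAt_chartLeft idPt_mem_target).unique ?_
  refine (hasFDerivAt_id _).congr_of_eventuallyEq ?_
  filter_upwards [isOpen_idChart_target.mem_nhds (idPt_mem_target (E := E) (H := H))] with b hb
  exact chartMul_left hb

theorem chartRight_idPt : chartRight E H (idPt E H) = ContinuousLinearMap.id ℝ E := by
  refine (hasFDerivAt_chartRight idPt_mem_target).unique ?_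
  refine (hasFDerivAt_id _).congr_of_eventuallyEq ?_
  filter_upwards [isOpen_idChart_target.mem_nhds (idPt_mem_target (E := E) (H := H))] with b hb
  exact chartMul_right hb

theorem fderiv_chartLeft_apply (u v : E) :
    fderiv ℝ (chartLeft E H) (idPt E H) u v =
      fderiv ℝ (fderiv ℝ (chartMul E H)) (idPt E H, idPt E H) (u, 0) (0, v) := by
  have h1 : HasFDerivAt (fderiv ℝ (chartMul E H)) _ (idPt E H, idPt E H) :=
    (((contDiffAt_chartMul_right (idPt_mem_target (E := E) (H := H))).fderiv_right
      (m := ∞) (by simp)).differentiableAt (by simp)).hasFDerivAt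
  have h2 := HasFDerivAt.comp (f := fun b => (b, idPt E H)) (idPt E H) h1
    (hasFDerivAt_prodMk_left (idPt E H) (idPt E H))
  have h3 := h2.clm_comp (hasFDerivAt_const (ContinuousLinearMap.inr ℝ E E) (idPt E H))
  have h4 : HasFDerivAt (chartLeft E H) _ (idPt E H) := h3
  rw [h4.fderiv]
  simp

theorem fderiv_chartRight_apply (u v : E) :
    fderiv ℝ (chartRight E H) (idPt E H) u v =
      fderiv ℝ (fderiv ℝ (chartMul E H)) (idPt E H, idPt E H) (0, u) (v, 0) := by
  have h1 : HasFDerivAt (fderiv ℝ (chartMul E H)) _ (idPt E H, idPt E H) :=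
    (((contDiffAt_chartMul_right (idPt_mem_target (E := E) (H := H))).fderiv_right
      (m := ∞) (by simp)).differentiableAt (by simp)).hasFDerivAt
  have h2 := HasFDerivAt.comp (idPt E H) h1 (hasFDerivAt_prodMk_right (idPt E H) (idPt E H))
  have h3 := h2.clm_comp (hasFDerivAt_const (ContinuousLinearMap.inl ℝ E E) (idPt E H))
  have h4 : HasFDerivAt (chartRight E H) _ (idPt E H) := h3
  rw [h4.fderiv]
  simp

/-- Symmetry of the second derivative of the group law. -/
theorem fderiv_chartRight_eq (u v : E) :
    fderiv ℝ (chartRight E H) (idPt E H) u v = fderiv ℝ (chartLeft E H) (idPt E H) v u := by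
  rw [fderiv_chartRight_apply, fderiv_chartLeft_apply]
  have h : ContDiffAt ℝ ∞ (chartMul E H) (idPt E H, idPt E H) :=
    contDiffAt_chartMul_right idPt_mem_target
  exact h.isSymmSndFDerivAt (by
    rw [minSmoothness_of_isRCLikeNormedField]; exact ENat.LEInfty.out) _ _

/-- The left-invariant vector fields, read in the chart. -/
theorem mfderiv_idChart_invField (x : E) {a : E}
    (ha : a ∈ (idChart E H).target) :
    (mfderiv 𝓘(ℝ, E) 𝓘(ℝ, E) (idChart E H) ((idChart E H).symm a) : E →L[ℝ] E)
      (invField H x ((idChart E H).symm a)) = chartLeft E H a x := by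
  set g := (idChart E H).symm a with hg
  have h1 : HasMFDerivAt 𝓘(ℝ, E) 𝓘(ℝ, E) (idChart E H).symm (idPt E H)
      (ContinuousLinearMap.id ℝ E) := by
    have h := ((contMDiffAt_idChart_symm (E := E) (H := H) idPt_mem_target).mdifferentiableAt
      (by simp)).hasMFDerivAt
    have h' := mfderivWithin_range_extChartAt_symm (I := 𝓘(ℝ, E)) (x := (1 : H))
    rw [modelWithCornersSelf_coe, Set.range_id, mfderivWithin_univ] at h'
    exact h.congr_mfderiv h'
  have h2 : ∀ q : H, q = 1 → HasMFDerivAt 𝓘(ℝ, E) 𝓘(ℝ, E) (fun h : H => g * h) q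
      (mfderiv 𝓘(ℝ, E) 𝓘(ℝ, E) (fun h : H => g * h) 1 : E →L[ℝ] E) := by
    rintro _ rfl
    exact ((contMDiff_mul_left (I := 𝓘(ℝ, E)) (n := ∞) (a := g)).mdifferentiableAt
      (by simp)).hasMFDerivAt
  have h3 : ∀ q : H, q = g → HasMFDerivAt 𝓘(ℝ, E) 𝓘(ℝ, E) (idChart E H) q
      (mfderiv 𝓘(ℝ, E) 𝓘(ℝ, E) (idChart E H) g : E →L[ℝ] E) := by
    rintro _ rfl
    exact ((contMDiffAt_idChart ((idChart E H).map_target ha)).mdifferentiableAt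
      (by simp)).hasMFDerivAt
  have h4 := HasMFDerivAt.comp (idPt E H) (h2 _ idChart_symm_idPt) h1
  have h5 := HasMFDerivAt.comp (idPt E H) (h3 _ (by simp [idChart_symm_idPt])) h4
  have h6 : ∀ A : E →L[ℝ] E, HasMFDerivAt 𝓘(ℝ, E) 𝓘(ℝ, E) (fun b => chartMul E H (a, b))
      (idPt E H) A → A = chartLeft E H a := fun A hA =>
    have hA' : HasFDerivAt (fun b => chartMul E H (a, b)) A (idPt E H) :=
      hasMFDerivAt_iff_hasFDerivAt.1 hA
    hA'.unique (hasFDerivAt_chartLeft ha)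
  exact congrArg (fun A : E →L[ℝ] E => A x) (h6 _ h5)

/-- The left-invariant vector fields, read in the chart as pullbacks, which is the form in which
they enter the definition of their bracket. -/
theorem mpullbackWithin_invField (x : E) {a : E}
    (ha : a ∈ (idChart E H).target) :
    (VectorField.mpullbackWithin 𝓘(ℝ, E) 𝓘(ℝ, E) (idChart E H).symm (invField H x)
      (range 𝓘(ℝ, E)) a : E) = chartLeft E H a x := by
  have : IsManifold 𝓘(ℝ, E) 1 H := IsManifold.of_le (n := ∞) (by simp)
  rw [VectorField.mpullbackWithin_apply]
  have h : (mfderivWithin 𝓘(ℝ, E) 𝓘(ℝ, E) (idChart E H).symm (range 𝓘(ℝ, E)) a :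
      E →L[ℝ] E).inverse =
      (mfderiv 𝓘(ℝ, E) 𝓘(ℝ, E) (idChart E H) ((idChart E H).symm a) : E →L[ℝ] E) :=
    ContinuousLinearMap.inverse_eq (M := E) (M₂ := E)
    (mfderivWithin_extChartAt_symm_comp_mfderiv_extChartAt (I := 𝓘(ℝ, E)) (x := (1 : H)) ha)
    (mfderiv_extChartAt_comp_mfderivWithin_extChartAt_symm (I := 𝓘(ℝ, E)) (x := (1 : H)) ha)
  refine Eq.trans ?_ (mfderiv_idChart_invField x ha)
  exact congrArg (fun A : E →L[ℝ] E => A (invField H x ((idChart E H).symm a))) h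

/-- The bracket of the Lie algebra, computed in the chart: `dL` at the identity is the identity map,
and the left-invariant field of `x` reads `a ↦ dL_a x`. -/
theorem lie_eq_lieBr (x y : GroupLieAlgebra 𝓘(ℝ, E) H) :
    (⁅x, y⁆ : GroupLieAlgebra 𝓘(ℝ, E) H) = lieBr E H x y := by
  change _ = fderiv ℝ (chartLeft E H) (idPt E H) x y - fderiv ℝ (chartLeft E H) (idPt E H) y x
  have : IsManifold 𝓘(ℝ, E) 1 H := IsManifold.of_le (n := ∞) (by simp)
  have hL : ∀ v : E, HasFDerivAt (fun a => chartLeft E H a v)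
      ((fderiv ℝ (chartLeft E H) (idPt E H)).flip v) (idPt E H) := by
    intro v
    have h1 : HasFDerivAt (chartLeft E H) _ (idPt E H) :=
      ((contDiffAt_chartLeft idPt_mem_target).differentiableAt (by simp)).hasFDerivAt
    refine (h1.clm_apply (hasFDerivAt_const v (idPt E H))).congr_fderiv ?_
    ext; simp
  have hV : ∀ x : E, HasFDerivAt
      (VectorField.mpullbackWithin 𝓘(ℝ, E) 𝓘(ℝ, E) (idChart E H).symm (invField H x)
        (range 𝓘(ℝ, E)) : E → E)
      ((fderiv ℝ (chartLeft E H) (idPt E H)).flip x) (idPt E H) := by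
    intro x
    refine (hL x).congr_of_eventuallyEq ?_
    filter_upwards [isOpen_idChart_target.mem_nhds (idPt_mem_target (E := E) (H := H))] with a ha
    exact mpullbackWithin_invField x ha
  have hv : ∀ x : E, (VectorField.mpullbackWithin 𝓘(ℝ, E) 𝓘(ℝ, E)
      (idChart E H).symm (invField H x) (range 𝓘(ℝ, E)) (idPt E H) : E) = x := by
    intro x
    rw [mpullbackWithin_invField x idPt_mem_target, chartLeft_idPt]
    rfl
  have hbr : ∀ (V W : E → E) (V' W' : E →L[ℝ] E) (s : Set E) (v w : E), s = univ →
      HasFDerivAt V V' (idPt E H) → HasFDerivAt W W' (idPt E H) → V (idPt E H) = v →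
      W (idPt E H) = w →
      VectorField.lieBracketWithin ℝ V W s (idPt E H) = W' v - V' w := by
    rintro V W V' W' s v w rfl h1 h2 rfl rfl
    rw [VectorField.lieBracketWithin_univ, ← h1.fderiv, ← h2.fderiv]
    rfl
  rw [GroupLieAlgebra.bracket_def, ← VectorField.mlieBracketWithin_univ,
    VectorField.mlieBracketWithin_apply]
  have h0 : (mfderiv 𝓘(ℝ, E) 𝓘(ℝ, E) (idChart E H) (1 : H) : E →L[ℝ] E).inverse =
      ContinuousLinearMap.id ℝ E :=
    (congrArg (fun A : E →L[ℝ] E => A.inverse) (mfderiv_extChartAt_self (x := (1 : H)))).trans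
      ContinuousLinearMap.inverse_id
  refine (congrArg (fun A : E →L[ℝ] E => A _) h0).trans ?_
  exact hbr _ _ ((fderiv ℝ (chartLeft E H) (idPt E H)).flip x)
    ((fderiv ℝ (chartLeft E H) (idPt E H)).flip y) _ x y (by simp) (hV x) (hV y) (hv x) (hv y)

end Chart

/-! ### The adjoint action -/

section Adjoint

variable {E : Type*} [NormedAddCommGroup E] [NormedSpace ℝ E]
  {H : Type*} [TopologicalSpace H] [ChartedSpace E H] [Group H]

theorem IsOneParam.hasDerivAt_zero {x : E} {γ : ℝ → H}
    (h : IsOneParam x γ) : HasDerivAt (fun s => idChart E H (γ s)) x 0 :=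
  ((hasMFDerivAt_curve_iff (E := E) h.map_zero x).1 h.deriv).2

variable (E) in
/-- The adjoint action of `g` on the Lie algebra: the differential at the identity of the
conjugation by `g`. -/
noncomputable def lieAd (g : H) : E →L[ℝ] E :=
  mfderiv 𝓘(ℝ, E) 𝓘(ℝ, E) (MulAut.conj g : H → H) 1

theorem lieAd_one : lieAd E (1 : H) = ContinuousLinearMap.id ℝ E := by
  have : (MulAut.conj (1 : H) : H → H) = id := by rw [map_one]; rfl
  unfold lieAd
  rw [this, mfderiv_id]
  rfl

variable [LieGroup 𝓘(ℝ, E) ∞ H]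

theorem IsOneParam.continuous {x : E} {γ : ℝ → H}
    (h : IsOneParam x γ) : Continuous γ :=
  h.isMIntegralCurve.continuous

/-- In the chart at the identity, a one-parameter subgroup solves an ordinary differential equation
with smooth right-hand side. -/
theorem IsOneParam.hasDerivAt_idChart {x : E} {γ : ℝ → H}
    (h : IsOneParam x γ) {t : ℝ} (ht : γ t ∈ (idChart E H).source) :
    HasDerivAt (fun s => idChart E H (γ s)) (chartLeft E H (idChart E H (γ t)) x) t := by
  have h1 : HasDerivAt (fun s => chartMul E H (idChart E H (γ t), idChart E H (γ s)))
      (chartLeft E H (idChart E H (γ t)) x) 0 := by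
    have h0 : idPt E H = idChart E H (γ 0) := by rw [h.map_zero]; rfl
    have h2 := hasFDerivAt_chartLeft (E := E) (H := H) ((idChart E H).map_source ht)
    rw [h0] at h2
    exact h2.comp_hasDerivAt (0 : ℝ) h.hasDerivAt_zero
  have h2 : HasDerivAt (fun s => idChart E H (γ (t + s)))
      (chartLeft E H (idChart E H (γ t)) x) 0 := by
    refine h1.congr_of_eventuallyEq ?_
    have : ∀ᶠ s in 𝓝 (0 : ℝ), γ s ∈ (idChart E H).source :=
      h.continuous.continuousAt.eventually_mem (isOpen_idChart_source.mem_nhds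
        (by rw [h.map_zero]; exact one_mem_idChart_source))
    filter_upwards [this] with s hs
    simp only [chartMul]
    rw [(idChart E H).left_inv ht, (idChart E H).left_inv hs, h.map_add]
  rw [← sub_self t] at h2
  have h3 := h2.comp_sub_const t t
  simpa using h3

/-- One-parameter subgroups are smooth: near `0` by bootstrapping the differential equation, and
elsewhere by translation. -/
theorem IsOneParam.contMDiff {x : E} {γ : ℝ → H} (h : IsOneParam x γ) :
    ContMDiff 𝓘(ℝ, ℝ) 𝓘(ℝ, E) ∞ γ := by
  set S : Set ℝ := γ ⁻¹' (idChart E H).source with hS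
  have hSo : IsOpen S := isOpen_idChart_source.preimage h.continuous
  have h0 : (0 : ℝ) ∈ S := by
    rw [hS, mem_preimage, h.map_zero]; exact one_mem_idChart_source
  have hd : ∀ t ∈ S, HasDerivAt (fun s => idChart E H (γ s))
      (chartLeft E H (idChart E H (γ t)) x) t := fun t ht => h.hasDerivAt_idChart ht
  have hn : ∀ n : ℕ, ContDiffOn ℝ n (fun s => idChart E H (γ s)) S := by
    intro n
    induction n with
    | zero =>
      rw [Nat.cast_zero, contDiffOn_zero]
      exact fun t ht => (hd t ht).continuousAt.continuousWithinAt
    | succ n ih =>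
      rw [Nat.cast_succ, contDiffOn_succ_iff_deriv_of_isOpen hSo]
      refine ⟨fun t ht => (hd t ht).differentiableAt.differentiableWithinAt, by simp, ?_⟩
      have h1 : ContDiffOn ℝ n (fun t => chartLeft E H (idChart E H (γ t)) (x : E)) S := by
        intro t ht
        have h2 : ContDiffAt ℝ n (chartLeft E H) (idChart E H (γ t)) :=
          (contDiffAt_chartLeft ((idChart E H).map_source ht)).of_le
            (by exact_mod_cast le_top)
        exact (h2.comp_contDiffWithinAt t (ih t ht)).clm_apply contDiffWithinAt_const
      exact h1.congr fun t ht => (hd t ht).deriv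
  have hc0 : ContMDiffAt 𝓘(ℝ, ℝ) 𝓘(ℝ, E) ∞ γ 0 := by
    have h1 : ContDiffAt ℝ ∞ (fun s => idChart E H (γ s)) 0 :=
      (contDiffOn_infty.2 hn).contDiffAt (hSo.mem_nhds h0)
    have h2 : ContMDiffAt 𝓘(ℝ, ℝ) 𝓘(ℝ, E) ∞ (fun s => (idChart E H).symm (idChart E H (γ s))) 0 :=
      ContMDiffAt.comp (0 : ℝ) (contMDiffAt_idChart_symm ((idChart E H).map_source h0))
        h1.contMDiffAt
    refine h2.congr_of_eventuallyEq ?_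
    filter_upwards [hSo.mem_nhds h0] with s hs
    exact ((idChart E H).left_inv hs).symm
  intro t
  have h1 : γ = fun s => γ t * γ (s - t) := by
    funext s; rw [← h.map_add]; congr 1; ring
  rw [h1]
  refine contMDiffAt_const.mul ?_
  refine ContMDiffAt.comp (f := fun s : ℝ => s - t) t (by simpa using hc0) ?_
  exact (contDiff_id.sub contDiff_const).contMDiff.contMDiffAt

theorem contMDiff_conj (g : H) : ContMDiff 𝓘(ℝ, E) 𝓘(ℝ, E) ∞ (MulAut.conj g : H → H) :=
  (contMDiff_const.mul contMDiff_id).mul contMDiff_const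

theorem hasMFDerivAt_conj (g : H) {q : H} (hq : q = 1) :
    HasMFDerivAt 𝓘(ℝ, E) 𝓘(ℝ, E) (MulAut.conj g : H → H) q (lieAd E g) := by
  subst hq
  exact ((contMDiff_conj g).mdifferentiableAt (by simp)).hasMFDerivAt

theorem lieAd_mul (g h : H) : lieAd E (g * h) = lieAd E g ∘L lieAd E h := by
  have h1 := HasMFDerivAt.comp (1 : H) (hasMFDerivAt_conj (E := E) g (map_one (MulAut.conj h)))
    (hasMFDerivAt_conj (E := E) h rfl)
  have h2 : (MulAut.conj g : H → H) ∘ (MulAut.conj h : H → H) = MulAut.conj (g * h) := by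
    rw [map_mul]; rfl
  rw [h2] at h1
  exact h1.mfderiv

/-- Left translation by `g` is conjugation by `g` followed by right translation by `g`. -/
theorem chartLeft_eq_chartRight_comp_lieAd {a : E} (ha : a ∈ (idChart E H).target) :
    chartLeft E H a = chartRight E H a ∘L lieAd E ((idChart E H).symm a) := by
  set g := (idChart E H).symm a with hg
  have h1 : HasMFDerivAt 𝓘(ℝ, E) 𝓘(ℝ, E) (idChart E H).symm (idPt E H)
      (ContinuousLinearMap.id ℝ E) := by
    have h := ((contMDiffAt_idChart_symm (E := E) (H := H) idPt_mem_target).mdifferentiableAt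
      (by simp)).hasMFDerivAt
    have h' := mfderivWithin_range_extChartAt_symm (I := 𝓘(ℝ, E)) (x := (1 : H))
    rw [modelWithCornersSelf_coe, Set.range_id, mfderivWithin_univ] at h'
    exact h.congr_mfderiv h'
  have h3 : ∀ q : H, q = 1 → HasMFDerivAt 𝓘(ℝ, E) 𝓘(ℝ, E) (idChart E H) q
      (ContinuousLinearMap.id ℝ E) := by
    rintro _ rfl
    exact (((contMDiffAt_idChart one_mem_idChart_source).mdifferentiableAt
      (by simp)).hasMFDerivAt).congr_mfderiv mfderiv_extChartAt_self
  have h4 := HasMFDerivAt.comp (idPt E H) (hasMFDerivAt_conj (E := E) g idChart_symm_idPt) h1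
  have h5 := HasMFDerivAt.comp (idPt E H) (h3 _ (by simp [idChart_symm_idPt])) h4
  have hK : HasFDerivAt (fun b => idChart E H (MulAut.conj g ((idChart E H).symm b)))
      (lieAd E g) (idPt E H) := hasMFDerivAt_iff_hasFDerivAt.1 h5
  have hK0 : idChart E H (MulAut.conj g ((idChart E H).symm (idPt E H))) = idPt E H := by
    simp [idChart_symm_idPt]; rfl
  have hR := hasFDerivAt_chartRight (E := E) (H := H) ha
  rw [← hK0] at hR
  have h6 := hR.comp (idPt E H) hK
  have h7 : HasFDerivAt (fun b => chartMul E H (a, b))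
      (chartRight E H a ∘L lieAd E g) (idPt E H) := by
    refine h6.congr_of_eventuallyEq ?_
    have hev : ∀ᶠ b in 𝓝 (idPt E H), MulAut.conj g ((idChart E H).symm b) ∈
        (idChart E H).source := by
      have hc : ContinuousAt (fun b => MulAut.conj g ((idChart E H).symm b)) (idPt E H) :=
        ContinuousAt.comp (g := (MulAut.conj g : H → H))
          (contMDiff_conj (E := E) g).continuous.continuousAt
          (contMDiffAt_idChart_symm (E := E) (H := H) idPt_mem_target).continuousAt
      refine hc.eventually_mem (isOpen_idChart_source.mem_nhds ?_)
      simp [idChart_symm_idPt, one_mem_idChart_source]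
    filter_upwards [hev] with b hb
    simp only [chartMul, Function.comp_apply]
    rw [(idChart E H).left_inv hb, ← hg]
    simp
  exact (hasFDerivAt_chartLeft ha).unique h7

variable [CompleteSpace E]

theorem conj_lieExp (g : H) (y : E) :
    g * lieExp y * g⁻¹ = lieExp (lieAd E g y) :=
  map_lieExp (MulAut.conj g).toMonoidHom (contMDiff_conj g) y

/-- The differential of the adjoint action at the identity is the bracket: differentiate
`Ad = (dR)⁻¹ ∘ dL`, with `dL` and `dR` the differentials of the translations. -/
theorem hasFDerivAt_lieAd : HasFDerivAt (fun a : E => lieAd E ((idChart E H).symm a))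
    (lieBr E H) (idPt E H) := by
  have hL : HasFDerivAt (chartLeft E H) _ (idPt E H) :=
    ((contDiffAt_chartLeft idPt_mem_target).differentiableAt (by simp)).hasFDerivAt
  have hR : HasFDerivAt (chartRight E H) _ (idPt E H) :=
    ((contDiffAt_chartRight idPt_mem_target).differentiableAt (by simp)).hasFDerivAt
  have hi := hasFDerivAt_ringInverse (𝕜 := ℝ) (1 : (E →L[ℝ] E)ˣ)
  have hR1 : ((1 : (E →L[ℝ] E)ˣ) : E →L[ℝ] E) = chartRight E H (idPt E H) := by
    rw [chartRight_idPt]; rfl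
  rw [hR1] at hi
  have hRi := hi.comp (idPt E H) hR
  have h3 : Ring.inverse (chartRight E H (idPt E H)) = ContinuousLinearMap.id ℝ E := by
    rw [← hR1, Ring.inverse_unit]; rfl
  have h1 := hRi.clm_comp hL
  have h2 : HasFDerivAt (fun a => Ring.inverse (chartRight E H a) ∘L chartLeft E H a)
      (lieBr E H) (idPt E H) := by
    refine h1.congr_fderiv ?_
    ext u v
    simp only [Function.comp_apply, h3, chartLeft_idPt, lieBr]
    simp [← fderiv_chartRight_eq, sub_eq_add_neg]
  refine h2.congr_of_eventuallyEq ?_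
  have hu : ∀ᶠ a in 𝓝 (idPt E H), IsUnit (chartRight E H a) :=
    hR.continuousAt.eventually_mem (Units.isOpen.mem_nhds (by
      rw [← hR1]; exact Units.isUnit _))
  filter_upwards [hu, isOpen_idChart_target.mem_nhds (idPt_mem_target (E := E) (H := H))]
    with a ha1 ha2
  rw [chartLeft_eq_chartRight_comp_lieAd ha2]
  exact (Ring.inverse_mul_cancel_left _ _ ha1).symm

theorem hasDerivAt_lieAd_zero (x y : E) :
    HasDerivAt (fun t : ℝ => lieAd E (lieExp (t • x) : H) y) (lieBr E H x y) 0 := by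
  have h := isOneParam_lieExp (H := H) x
  have h0 : idPt E H = idChart E H (lieExp ((0 : ℝ) • x)) := by rw [h.map_zero]; rfl
  have h2 := hasFDerivAt_lieAd (E := E) (H := H)
  rw [h0] at h2
  have h3 := h2.comp_hasDerivAt (0 : ℝ) h.hasDerivAt_zero
  have h4 : HasDerivAt (fun t : ℝ => lieAd E ((idChart E H).symm (idChart E H (lieExp (t • x)))) y)
      (lieBr E H x y) 0 := by
    refine (h3.clm_apply (hasDerivAt_const (0 : ℝ) y)).congr_deriv ?_
    simp
  refine h4.congr_of_eventuallyEq ?_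
  have : ∀ᶠ s in 𝓝 (0 : ℝ), lieExp (s • x) ∈ (idChart E H).source :=
    h.continuous.continuousAt.eventually_mem (isOpen_idChart_source.mem_nhds
      (by rw [zero_smul, lieExp_zero]; exact one_mem_idChart_source))
  filter_upwards [this] with s hs
  rw [(idChart E H).left_inv hs]

theorem hasDerivAt_lieAd (x y : E) (t : ℝ) :
    HasDerivAt (fun t : ℝ => lieAd E (lieExp (t • x) : H) y)
      (lieAd E (lieExp (t • x) : H) (lieBr E H x y)) t := by
  have h1 := (lieAd E (lieExp (t • x) : H)).hasFDerivAt.comp_hasDerivAt (0 : ℝ)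
    (hasDerivAt_lieAd_zero (H := H) x y)
  rw [← sub_self t] at h1
  have h2 := h1.comp_sub_const t t
  refine h2.congr_of_eventuallyEq (Eventually.of_forall fun s => ?_)
  simp only [Function.comp_apply]
  rw [← ContinuousLinearMap.comp_apply, ← lieAd_mul, ← lieExp_add_smul]
  congr 4; ring

/-- The adjoint action of `exp x` on an element commuting with `x`. -/
theorem lieAd_lieExp_of_lieBr_eq_zero {x y : E} (h : lieBr E H x y = 0) (t : ℝ) :
    lieAd E (lieExp (t • x) : H) y = y := by
  have hd : ∀ t : ℝ, HasDerivAt (fun t : ℝ => lieAd E (lieExp (t • x) : H) y) 0 t := by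
    intro t
    have := hasDerivAt_lieAd (H := H) x y t
    rwa [h, map_zero] at this
  have h1 := is_const_of_deriv_eq_zero (fun t => (hd t).differentiableAt)
    (fun t => (hd t).deriv) t 0
  simpa [lieExp_zero, lieAd_one] using h1

/-- The adjoint action of `exp (t x)` on an element `y` with `[x, [x, y]] = 0`. -/
theorem lieAd_lieExp {x y : E} (h : lieBr E H x (lieBr E H x y) = 0) (t : ℝ) :
    lieAd E (lieExp (t • x) : H) y = y + t • lieBr E H x y := by
  have hd : ∀ t : ℝ, HasDerivAt (fun t : ℝ => lieAd E (lieExp (t • x) : H) y -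
      t • lieBr E H x y) 0 t := by
    intro t
    have := hasDerivAt_lieAd (H := H) x y t
    rw [lieAd_lieExp_of_lieBr_eq_zero h] at this
    refine (this.sub ((hasDerivAt_id t).smul_const (lieBr E H x y))).congr_deriv ?_
    simp
  have h1 := is_const_of_deriv_eq_zero (fun t => (hd t).differentiableAt)
    (fun t => (hd t).deriv) t 0
  simp only [lieExp_zero, lieAd_one, zero_smul, sub_zero] at h1
  exact sub_eq_iff_eq_add.1 h1

end Adjoint

/-! ### The Baker-Campbell-Hausdorff formula in the two-step nilpotent case -/

section BCH

variable {E : Type*} [NormedAddCommGroup E] [NormedSpace ℝ E]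
  {H : Type*} [TopologicalSpace H] [ChartedSpace E H] [Group H]

theorem lieBr_self (x : E) : lieBr E H x x = 0 := by
  simp [lieBr]

theorem lieBr_swap (x y : E) : lieBr E H x y = -lieBr E H y x := by
  simp [lieBr]

variable [LieGroup 𝓘(ℝ, E) ∞ H]

/-- The velocity at the identity of a product of two curves is the sum of their velocities. -/
theorem hasMFDerivAt_mul_curve {c d : ℝ → H} {x y : E} (hc0 : c 0 = 1) (hd0 : d 0 = 1)
    (hc : HasMFDerivAt 𝓘(ℝ, ℝ) 𝓘(ℝ, E) c 0
      (ContinuousLinearMap.toSpanSingleton ℝ x : ℝ →L[ℝ] E))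
    (hd : HasMFDerivAt 𝓘(ℝ, ℝ) 𝓘(ℝ, E) d 0
      (ContinuousLinearMap.toSpanSingleton ℝ y : ℝ →L[ℝ] E)) :
    HasMFDerivAt 𝓘(ℝ, ℝ) 𝓘(ℝ, E) (fun t => c t * d t) 0
      (ContinuousLinearMap.toSpanSingleton ℝ (x + y) : ℝ →L[ℝ] E) := by
  have := topologicalGroup_of_lieGroup 𝓘(ℝ, E) ∞ (G := H)
  obtain ⟨hc1, hc2⟩ := (hasMFDerivAt_curve_iff hc0 x).1 hc
  obtain ⟨hd1, hd2⟩ := (hasMFDerivAt_curve_iff hd0 y).1 hd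
  refine (hasMFDerivAt_curve_iff (h := 1) (by simp [hc0, hd0]) _).2 ⟨hc1.mul hd1, ?_⟩
  have hm : HasFDerivAt (chartMul E H) _ (idPt E H, idPt E H) :=
    ((contDiffAt_chartMul_right idPt_mem_target).differentiableAt (by simp)).hasFDerivAt
  have hp : (idPt E H, idPt E H) = (idChart E H (c 0), idChart E H (d 0)) := by
    rw [hc0, hd0]; rfl
  rw [hp] at hm
  have h1 := hm.comp_hasDerivAt (0 : ℝ) (hc2.prodMk hd2)
  rw [← hp] at h1
  have h2 : fderiv ℝ (chartMul E H) (idPt E H, idPt E H) (x, y) = x + y := by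
    have hxy : (x, y) = ContinuousLinearMap.inl ℝ E E x + ContinuousLinearMap.inr ℝ E E y := by
      simp
    rw [hxy, map_add, ← ContinuousLinearMap.comp_apply, ← ContinuousLinearMap.comp_apply]
    change chartRight E H (idPt E H) x + chartLeft E H (idPt E H) y = _
    rw [chartRight_idPt, chartLeft_idPt]
    rfl
  refine (h1.congr_deriv h2).congr_of_eventuallyEq ?_
  have hs : (idChart E H).source ∈ 𝓝 (1 : H) :=
    isOpen_idChart_source.mem_nhds one_mem_idChart_source
  filter_upwards [hc1.eventually_mem (by rwa [hc0]), hd1.eventually_mem (by rwa [hd0])]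
    with t h1 h2
  simp only [chartMul, Function.comp_apply]
  erw [(idChart E H).left_inv h1, (idChart E H).left_inv h2]
  rfl

variable [CompleteSpace E]

theorem commute_lieExp {x y : E} (h : lieBr E H x y = 0) :
    (lieExp x : H) * lieExp y = lieExp y * lieExp x := by
  have h1 := conj_lieExp (lieExp x : H) y
  have h2 := lieAd_lieExp_of_lieBr_eq_zero h 1
  rw [one_smul] at h2
  rw [h2] at h1
  exact mul_inv_eq_iff_eq_mul.1 h1

/-- The exponential map is additive on commuting elements. -/
theorem lieExp_add {x y : E} (h : lieBr E H x y = 0) :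
    (lieExp (x + y) : H) = lieExp x * lieExp y := by
  have hst : ∀ s t : ℝ, (lieExp (s • x) : H) * lieExp (t • y) = lieExp (t • y) * lieExp (s • x) :=
    fun s t => commute_lieExp (by simp [h])
  have h1 : IsOneParam (x + y) (fun t : ℝ => (lieExp (t • x) : H) * lieExp (t • y)) := by
    refine ⟨fun s t => ?_, hasMFDerivAt_mul_curve (by simp [lieExp_zero]) (by simp [lieExp_zero])
      (isOneParam_lieExp x).deriv (isOneParam_lieExp y).deriv⟩
    rw [lieExp_add_smul, lieExp_add_smul, mul_assoc, mul_assoc]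
    congr 1
    rw [← mul_assoc, ← mul_assoc]
    congr 1
    exact hst t s
  simpa using h1.lieExp_eq

/-- The Baker-Campbell-Hausdorff formula for a two-step nilpotent Lie algebra. -/
theorem lieExp_mul_lieExp (h2 : ∀ x y z : E, lieBr E H x (lieBr E H y z) = 0) (x y : E) :
    (lieExp x : H) * lieExp y = lieExp (x + y + (1 / 2 : ℝ) • lieBr E H x y) := by
  set z := lieBr E H x y with hz
  have hcz : ∀ (u : E) (s t : ℝ), (lieExp (s • u) : H) * lieExp (t • z) =
      lieExp (t • z) * lieExp (s • u) := fun u s t => commute_lieExp (by simp [hz, h2])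
  -- `exp (s y) * exp (t x) = exp (t x) * exp (s y) * exp (-(s t) [x, y])`, from `Ad (exp (t x))`.
  have hxy : ∀ s t : ℝ, (lieExp (s • y) : H) * lieExp (t • x) =
      lieExp (t • x) * lieExp (s • y) * lieExp ((-(s * t)) • z) := by
    intro s t
    have h1 := conj_lieExp (lieExp (t • x) : H) (s • y)
    rw [lieAd_lieExp (by simp [h2]), lieExp_add (by simp [h2]), mul_inv_eq_iff_eq_mul,
      map_smul, ← hz, smul_smul] at h1
    rw [h1, mul_assoc, mul_assoc, hcz, ← mul_assoc (lieExp ((t * s) • z) : H),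
      ← lieExp_add_smul, mul_comm t s, add_neg_cancel, zero_smul, lieExp_zero, one_mul]
  have hZ : HasMFDerivAt 𝓘(ℝ, ℝ) 𝓘(ℝ, E) (fun t : ℝ => (lieExp ((-(t ^ 2 / 2)) • z) : H)) 0
      (ContinuousLinearMap.toSpanSingleton ℝ (0 : E) : ℝ →L[ℝ] E) := by
    have hd := (isOneParam_lieExp (H := H) z)
    refine (hasMFDerivAt_curve_iff (h := 1) (by simp [lieExp_zero]) _).2 ⟨?_, ?_⟩
    · exact ContinuousAt.comp (g := fun t : ℝ => (lieExp (t • z) : H))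
        (f := fun t : ℝ => -(t ^ 2 / 2)) hd.continuous.continuousAt (by fun_prop)
    · have h1 := hd.hasDerivAt_zero
      have h0 : (0 : ℝ) = -(0 ^ 2 / 2) := by simp
      nth_rw 1 [h0] at h1
      have h3 : HasDerivAt (fun t : ℝ => -(t ^ 2 / 2)) 0 0 := by
        exact ((((hasDerivAt_id' (0 : ℝ)).fun_pow 2).div_const 2).fun_neg).congr_deriv (by simp)
      have := h1.scomp (0 : ℝ) h3
      rw [zero_smul] at this
      exact this
  -- The quadratic factor corrects the product to a homomorphism without changing its velocity.
  have h1 : IsOneParam (x + y) (fun t : ℝ => (lieExp (t • x) : H) * lieExp (t • y) *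
      lieExp ((-(t ^ 2 / 2)) • z)) := by
    refine ⟨fun s t => ?_, ?_⟩
    · have e1 : (lieExp ((-((s + t) ^ 2 / 2)) • z) : H) = lieExp ((-(s * t)) • z) *
          (lieExp ((-(s ^ 2 / 2)) • z) * lieExp ((-(t ^ 2 / 2)) • z)) := by
        rw [← lieExp_add_smul, ← lieExp_add_smul]; congr 2; ring
      calc (lieExp ((s + t) • x) : H) * lieExp ((s + t) • y) * lieExp ((-((s + t) ^ 2 / 2)) • z)
          = lieExp (s • x) * (lieExp (t • x) * lieExp (s • y) * (lieExp (t • y) *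
            lieExp ((-(s * t)) • z))) *
            (lieExp ((-(s ^ 2 / 2)) • z) * lieExp ((-(t ^ 2 / 2)) • z)) := by
            rw [e1, lieExp_add_smul, lieExp_add_smul]; simp only [mul_assoc]
        _ = lieExp (s • x) * (lieExp (s • y) * lieExp (t • x) * lieExp (t • y)) *
            (lieExp ((-(s ^ 2 / 2)) • z) * lieExp ((-(t ^ 2 / 2)) • z)) := by
            rw [hcz y, hxy s t]; simp only [mul_assoc]
        _ = lieExp (s • x) * lieExp (s • y) * (lieExp (t • x) * (lieExp (t • y) *
            lieExp ((-(s ^ 2 / 2)) • z))) * lieExp ((-(t ^ 2 / 2)) • z) := by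
            simp only [mul_assoc]
        _ = lieExp (s • x) * lieExp (s • y) * (lieExp ((-(s ^ 2 / 2)) • z) * lieExp (t • x) *
            lieExp (t • y)) * lieExp ((-(t ^ 2 / 2)) • z) := by
            rw [hcz y, ← mul_assoc (lieExp (t • x) : H), hcz x]
        _ = _ := by simp only [mul_assoc]
    · have := hasMFDerivAt_mul_curve (by simp [lieExp_zero]) (by simp [lieExp_zero])
        (hasMFDerivAt_mul_curve (by simp [lieExp_zero]) (by simp [lieExp_zero])
          (isOneParam_lieExp (H := H) x).deriv (isOneParam_lieExp (H := H) y).deriv) hZ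
      rwa [add_zero] at this
  have h3 := h1.lieExp_eq
  rw [lieExp_add (by simp [hz, h2]), h3]
  simp only [one_smul, one_pow]
  rw [mul_assoc _ (lieExp _), ← lieExp_add_smul]
  simp [lieExp_zero]

end BCH

/-! ### The exponential map of a simply connected two-step nilpotent group -/

section Diffeo

variable {E : Type*} [NormedAddCommGroup E] [NormedSpace ℝ E]
  {H : Type*} [TopologicalSpace H] [ChartedSpace E H] [Group H] [LieGroup 𝓘(ℝ, E) ∞ H]

section Smooth

variable [CompleteSpace E]

theorem contMDiff_lieExp_smul {c : E → ℝ} (hc : ContDiff ℝ ∞ c) (v : E) :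
    ContMDiff 𝓘(ℝ, E) 𝓘(ℝ, E) ∞ (fun p => (lieExp (c p • v) : H)) :=
  (isOneParam_lieExp (H := H) v).contMDiff.comp hc.contMDiff

theorem contMDiff_lieExp_sum_of_central {ι : Type*} (s : Finset ι) (c : ι → E → ℝ) (v : ι → E)
    (hc : ∀ i, ContDiff ℝ ∞ (c i)) (hv : ∀ i y, lieBr E H (v i) y = 0) :
    ContMDiff 𝓘(ℝ, E) 𝓘(ℝ, E) ∞ (fun p => (lieExp (∑ i ∈ s, c i p • v i) : H)) := by
  classical
  induction s using Finset.induction_on with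
  | empty => simpa using contMDiff_const
  | insert j s hj ih =>
    simp only [Finset.sum_insert hj]
    have : ∀ p, (lieExp (c j p • v j + ∑ i ∈ s, c i p • v i) : H) =
        lieExp (c j p • v j) * lieExp (∑ i ∈ s, c i p • v i) := fun p =>
      lieExp_add (by simp [hv])
    simp only [this]
    exact (contMDiff_lieExp_smul (hc j) (v j)).mul ih

/-- The exponential of a vector with smooth coordinates is a product of exponentials of multiples of
the vectors `v i`, up to the exponential of a central vector with smooth coordinates. -/
theorem contMDiff_lieExp_sum (h2 : ∀ x y z : E, lieBr E H x (lieBr E H y z) = 0)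
    {ι : Type*} (s : Finset ι) (c : ι → E → ℝ) (v : ι → E) (hc : ∀ i, ContDiff ℝ ∞ (c i)) :
    ContMDiff 𝓘(ℝ, E) 𝓘(ℝ, E) ∞ (fun p => (lieExp (∑ i ∈ s, c i p • v i) : H)) := by
  classical
  induction s using Finset.induction_on with
  | empty => simpa using contMDiff_const
  | insert j s hj ih =>
    simp only [Finset.sum_insert hj]
    have h2' : ∀ x y z : E, lieBr E H (lieBr E H y z) x = 0 := fun x y z => by
      rw [lieBr_swap, h2, neg_zero]
    have : ∀ p, (lieExp (c j p • v j + ∑ i ∈ s, c i p • v i) : H) =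
        lieExp (c j p • v j) * lieExp (∑ i ∈ s, c i p • v i) *
          (lieExp (∑ i ∈ s, (1 / 2 * c j p * c i p) • lieBr E H (v j) (v i)))⁻¹ := by
      intro p
      rw [eq_mul_inv_iff_mul_eq, lieExp_mul_lieExp h2 (c j p • v j), ← lieExp_add]
      · congr 1
        simp [Finset.smul_sum, smul_smul, mul_assoc, mul_comm, mul_left_comm]
      · simp [h2]
    simp only [this]
    refine ((contMDiff_lieExp_smul (hc j) (v j)).mul ih).mul (ContMDiff.inv ?_)
    exact contMDiff_lieExp_sum_of_central s _ _ (fun i => (contDiff_const.mul (hc j)).mul (hc i))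
      fun i y => h2' _ _ _

end Smooth

variable [FiniteDimensional ℝ E] [CompleteSpace E]

theorem contMDiff_lieExp (h2 : ∀ x y z : E, lieBr E H x (lieBr E H y z) = 0) :
    ContMDiff 𝓘(ℝ, E) 𝓘(ℝ, E) ∞ (lieExp : E → H) := by
  let b := Module.finBasis ℝ E
  have h := contMDiff_lieExp_sum h2 Finset.univ (fun i p => b.repr p i) b
    (fun i => (LinearMap.toContinuousLinearMap (b.coord i)).contDiff)
  simpa [b.sum_repr] using h

theorem continuous_lieExp (h2 : ∀ x y z : E, lieBr E H x (lieBr E H y z) = 0) :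
    Continuous (lieExp : E → H) :=
  (contMDiff_lieExp h2).continuous

theorem contDiffAt_idChart_lieExp (h2 : ∀ x y z : E, lieBr E H x (lieBr E H y z) = 0) :
    ContDiffAt ℝ ∞ (fun x : E => idChart E H (lieExp x)) 0 := by
  rw [← contMDiffAt_iff_contDiffAt]
  exact ContMDiffAt.comp (0 : E) (contMDiffAt_idChart (by
    rw [lieExp_zero]; exact one_mem_idChart_source)) (contMDiff_lieExp h2).contMDiffAt

/-- The differential of the exponential map at `0` is the identity. -/
theorem hasFDerivAt_idChart_lieExp (h2 : ∀ x y z : E, lieBr E H x (lieBr E H y z) = 0) :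
    HasFDerivAt (fun x : E => idChart E H (lieExp x))
      ((ContinuousLinearEquiv.refl ℝ E : E ≃L[ℝ] E) : E →L[ℝ] E) 0 := by
  have h := ((contDiffAt_idChart_lieExp h2).differentiableAt (by simp)).hasFDerivAt
  refine h.congr_fderiv ?_
  ext x
  have h1 : HasDerivAt (fun t : ℝ => t • x) x 0 := by
    simpa using (hasDerivAt_id' (0 : ℝ)).smul_const x
  rw [← zero_smul ℝ x] at h
  have h3 := h.comp_hasDerivAt (0 : ℝ) h1
  rw [zero_smul] at h3
  exact h3.unique (isOneParam_lieExp (H := H) x).hasDerivAt_zero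

theorem map_nhds_lieExp (h2 : ∀ x y z : E, lieBr E H x (lieBr E H y z) = 0) :
    map (lieExp : E → H) (𝓝 0) = 𝓝 1 := by
  refine le_antisymm ?_ ?_
  · have := (continuous_lieExp (H := H) h2).tendsto 0
    rwa [lieExp_zero] at this
  · have hs := (contDiffAt_idChart_lieExp (H := H) h2).hasStrictFDerivAt'
      (hasFDerivAt_idChart_lieExp h2) (by simp)
    have h1 := hs.map_nhds_eq_of_equiv
    rw [lieExp_zero] at h1
    have hsrc : ∀ᶠ x in 𝓝 (0 : E), (lieExp x : H) ∈ (idChart E H).source :=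
      (continuous_lieExp h2).continuousAt.eventually_mem (isOpen_idChart_source.mem_nhds
        (by rw [lieExp_zero]; exact one_mem_idChart_source))
    have hc : ContinuousAt (idChart E H).symm (idChart E H 1) :=
      (contMDiffAt_idChart_symm (E := E) (H := H) idPt_mem_target).continuousAt
    have hm : map (lieExp : E → H) (𝓝 0) =
        map (idChart E H).symm (map (fun x : E => idChart E H (lieExp x)) (𝓝 0)) := by
      rw [map_map]
      refine map_congr ?_
      filter_upwards [hsrc] with x hx
      exact ((idChart E H).left_inv hx).symm
    rw [hm, h1]
    intro V hV
    rw [mem_map] at hV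
    have hc1 : ContinuousAt (idChart E H) (1 : H) :=
      (contMDiffAt_idChart (E := E) (H := H) one_mem_idChart_source).continuousAt
    filter_upwards [hc1.preimage_mem_nhds hV,
      isOpen_idChart_source.mem_nhds (one_mem_idChart_source (E := E) (H := H))] with h hh1 hh2
    rw [mem_preimage, mem_preimage, (idChart E H).left_inv hh2] at hh1
    exact hh1

/-- The simply connected group with a given two-step nilpotent Lie algebra: the underlying vector
space with the Baker-Campbell-Hausdorff product `x + y + [x, y] / 2`. -/
@[reducible] noncomputable def bchGroup
    (h2 : ∀ x y z : E, lieBr E H x (lieBr E H y z) = 0) : Group E :=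
  have h2' : ∀ x y z : E, lieBr E H (lieBr E H y z) x = 0 := fun x y z => by
    rw [lieBr_swap, h2, neg_zero]
  { mul := fun x y => x + y + (1 / 2 : ℝ) • lieBr E H x y
    one := (0 : E)
    inv := fun x => -x
    mul_assoc := fun x y z => by
      change (x + y + (1 / 2 : ℝ) • lieBr E H x y) + z +
        (1 / 2 : ℝ) • lieBr E H (x + y + (1 / 2 : ℝ) • lieBr E H x y) z =
        x + (y + z + (1 / 2 : ℝ) • lieBr E H y z) +
        (1 / 2 : ℝ) • lieBr E H x (y + z + (1 / 2 : ℝ) • lieBr E H y z)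
      simp [h2, h2']
      abel
    one_mul := fun x => by
      change (0 : E) + x + (1 / 2 : ℝ) • lieBr E H 0 x = x
      simp
    mul_one := fun x => by
      change x + (0 : E) + (1 / 2 : ℝ) • lieBr E H x 0 = x
      simp
    inv_mul_cancel := fun x => by
      change -x + x + (1 / 2 : ℝ) • lieBr E H (-x) x = (0 : E)
      simp [lieBr_self] }

/-- The exponential map is a homomorphism for the Baker-Campbell-Hausdorff product on `E` and a
local homeomorphism at the identity, hence a covering map onto the simply connected group `H`. -/
theorem lieExp_bijective [SimplyConnectedSpace H]
    (h2 : ∀ x y z : E, lieBr E H x (lieBr E H y z) = 0) :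
    Function.Bijective (lieExp : E → H) := by
  let : Group E := bchGroup h2
  have hmul : ∀ x y : E, x * y = x + y + (1 / 2 : ℝ) • lieBr E H x y := fun _ _ => rfl
  have hinv : ∀ x : E, x⁻¹ = -x := fun _ => rfl
  have hone : (1 : E) = 0 := rfl
  have : IsTopologicalGroup E :=
    { continuous_mul := by
        simp only [hmul]
        fun_prop
      continuous_inv := by
        simp only [hinv]
        fun_prop }
  have := topologicalGroup_of_lieGroup 𝓘(ℝ, E) ∞ (G := H)
  have := ChartedSpace.locallyPathConnectedSpace E H
  let f : E →* H :=
    { toFun := lieExp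
      map_one' := lieExp_zero
      map_mul' := fun x y => by rw [hmul, lieExp_mul_lieExp h2] }
  have hf : ∀ x, f x = lieExp x := fun _ => rfl
  have hfc : Continuous f := continuous_lieExp h2
  have hnhds : map f (𝓝 1) = 𝓝 1 := map_nhds_lieExp h2
  have hopen : IsOpenMap f := IsTopologicalGroup.isOpenMap_iff_nhds_one.2 hnhds.ge
  have hsurj : Function.Surjective f := by
    have ho : IsOpen (f.range : Set H) := Subgroup.isOpen_of_mem_nhds _ (g := 1) (by
      rw [← hnhds, MonoidHom.coe_range]; exact range_mem_map)
    have := IsClopen.eq_univ ⟨Subgroup.isClosed_of_isOpen _ ho, ho⟩ ⟨1, one_mem _⟩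
    rwa [MonoidHom.coe_range, range_eq_univ] at this
  refine ⟨?_, hsurj⟩
  have hq : IsQuotientMap f := hopen.isQuotientMap hfc hsurj
  have hdisc : IsDiscrete (f.ker : Set E) := by
    rw [isDiscrete_iff_discreteTopology]
    refine discreteTopology_of_isOpen_singleton_one (G := f.ker) ?_
    rw [isOpen_iff_mem_nhds]
    rintro _ rfl
    have hs := (contDiffAt_idChart_lieExp (H := H) h2).hasStrictFDerivAt'
      (hasFDerivAt_idChart_lieExp h2) (by simp)
    have h0 := hs.eventually_left_inverse.self_of_nhds
    have h1 : ∀ᶠ x in 𝓝 (1 : f.ker), _ :=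
      (continuous_subtype_val.tendsto (1 : f.ker)).eventually hs.eventually_left_inverse
    filter_upwards [h1] with x hx
    have hx1 : (lieExp (x : E) : H) = 1 := x.2
    rw [hx1, ← lieExp_zero (E := E), h0] at hx
    exact Subtype.ext hx.symm
  have hcov :=
    (IsQuotientMap.isQuotientCoveringMap_of_isDiscrete_ker_monoidHom hq hdisc).isCoveringMap
  -- A continuous section `g` of the covering through `0` is a left inverse by uniqueness of lifts.
  obtain ⟨g, ⟨hg1, hg2⟩, -⟩ := hcov.existsUnique_continuousMap_lifts
    (ContinuousMap.id H) (1 : H) (1 : E) (by simp)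
  have hgf : (g ∘ f) = id := by
    refine hcov.eq_of_comp_eq (g.continuous.comp hfc) continuous_id ?_ (1 : E) ?_
    · funext x
      exact congrFun hg2 (f x)
    · simpa using hg1
  exact Function.LeftInverse.injective (congrFun hgf)

end Diffeo

/-! ### The logarithm -/

section Log

variable {E : Type*} [NormedAddCommGroup E] [NormedSpace ℝ E] [FiniteDimensional ℝ E]
  [CompleteSpace E]
  {H : Type*} [TopologicalSpace H] [ChartedSpace E H] [Group H] [LieGroup 𝓘(ℝ, E) ∞ H]

variable (E) in
/-- The logarithm: the inverse of the exponential map (where the latter is bijective). -/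
noncomputable def lieLog (h : H) : E := Function.invFun (lieExp : E → H) h

variable [SimplyConnectedSpace H] (h2 : ∀ x y z : E, lieBr E H x (lieBr E H y z) = 0)

include h2

theorem lieExp_lieLog (h : H) : lieExp (lieLog E h) = h :=
  Function.rightInverse_invFun (lieExp_bijective h2).2 h

theorem lieLog_lieExp (x : E) : lieLog E (lieExp x : H) = x :=
  Function.leftInverse_invFun (lieExp_bijective h2).1 x

theorem lieLog_one : lieLog E (1 : H) = 0 := by
  rw [← lieExp_zero (E := E), lieLog_lieExp h2]

theorem lieLog_mul (g h : H) : lieLog E (g * h) =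
    lieLog E g + lieLog E h + (1 / 2 : ℝ) • lieBr E H (lieLog E g) (lieLog E h) := by
  apply (lieExp_bijective h2).1
  rw [← lieExp_mul_lieExp h2, lieExp_lieLog h2, lieExp_lieLog h2, lieExp_lieLog h2]

/-- Near the identity the logarithm is the local inverse given by the inverse function theorem. -/
theorem contMDiffAt_lieLog_one : ContMDiffAt 𝓘(ℝ, E) 𝓘(ℝ, E) ∞ (lieLog E : H → E) 1 := by
  have hc := contDiffAt_idChart_lieExp (H := H) h2
  have hd := hasFDerivAt_idChart_lieExp (H := H) h2
  have hl := hc.to_localInverse hd (by simp)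
  have hr := (hc.hasStrictFDerivAt' hd (by simp)).eventually_right_inverse
  have hl0 : hc.localInverse hd (by simp) (idChart E H (lieExp (0 : E))) = 0 :=
    (hc.hasStrictFDerivAt' hd (by simp)).localInverse_apply_image
  rw [lieExp_zero] at hl hr hl0
  have h1 : ContMDiffAt 𝓘(ℝ, E) 𝓘(ℝ, E) ∞
      (fun h : H => hc.localInverse hd (by simp) (idChart E H h)) 1 :=
    ContMDiffAt.comp (1 : H) hl.contMDiffAt (contMDiffAt_idChart one_mem_idChart_source)
  refine h1.congr_of_eventuallyEq ?_
  have hφ : ContinuousAt (idChart E H) (1 : H) :=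
    (contMDiffAt_idChart (E := E) (H := H) one_mem_idChart_source).continuousAt
  have hs : ∀ᶠ h in 𝓝 (1 : H),
      (lieExp (hc.localInverse hd (by simp) (idChart E H h)) : H) ∈ (idChart E H).source := by
    refine ((continuous_lieExp h2).continuousAt.comp h1.continuousAt).eventually_mem
      (isOpen_idChart_source.mem_nhds ?_)
    rw [Function.comp_apply, hl0, lieExp_zero]
    exact one_mem_idChart_source
  filter_upwards [hs, hφ.eventually hr,
    isOpen_idChart_source.mem_nhds (one_mem_idChart_source (E := E) (H := H))] with h ha hb hh
  have : (lieExp (hc.localInverse hd (by simp) (idChart E H h)) : H) = h :=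
    (idChart E H).injOn ha hh hb
  rw [← this, lieLog_lieExp h2, this]

/-- The logarithm is smooth everywhere, since `log (g * k)` is affine in `log k`. -/
theorem contMDiff_lieLog : ContMDiff 𝓘(ℝ, E) 𝓘(ℝ, E) ∞ (lieLog E : H → E) := by
  intro g
  have h1 : (lieLog E : H → E) = fun h => lieLog E g + lieLog E (g⁻¹ * h) +
      (1 / 2 : ℝ) • lieBr E H (lieLog E g) (lieLog E (g⁻¹ * h)) := by
    funext h
    rw [← lieLog_mul h2, mul_inv_cancel_left]
  have hl : ContMDiffAt 𝓘(ℝ, E) 𝓘(ℝ, E) ∞ (lieLog E : H → E) (g⁻¹ * g) := by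
    rw [inv_mul_cancel]
    exact contMDiffAt_lieLog_one h2
  have hg : ContMDiffAt 𝓘(ℝ, E) 𝓘(ℝ, E) ∞ (fun h => lieLog E (g⁻¹ * h)) g :=
    ContMDiffAt.comp (g := (lieLog E : H → E)) (f := fun h => g⁻¹ * h) g hl
      (contMDiff_mul_left (I := 𝓘(ℝ, E)) (n := ∞) (a := g⁻¹)).contMDiffAt
  have hP : ContDiff ℝ ∞ (fun v : E => lieLog E g + v +
      (1 / 2 : ℝ) • lieBr E H (lieLog E g) v) :=
    (contDiff_const.add contDiff_id).add ((lieBr E H _).contDiff.const_smul _)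
  rw [h1]
  exact ContMDiffAt.comp g hP.contMDiff.contMDiffAt hg

/-- The differential of the logarithm at the identity is the identity. -/
theorem hasDerivAt_lieLog {c : ℝ → H} {x : E} (hc0 : c 0 = 1)
    (hc : HasMFDerivAt 𝓘(ℝ, ℝ) 𝓘(ℝ, E) c 0
      (ContinuousLinearMap.toSpanSingleton ℝ x : ℝ →L[ℝ] E)) :
    HasDerivAt (fun t => lieLog E (c t)) x 0 := by
  have hl : MDifferentiableAt 𝓘(ℝ, E) 𝓘(ℝ, E) (lieLog E : H → E) (c 0) :=
    (contMDiff_lieLog h2).mdifferentiableAt (by simp)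
  have h1 : DifferentiableAt ℝ (fun t => lieLog E (c t)) 0 :=
    mdifferentiableAt_iff_differentiableAt.1 (hl.comp (0 : ℝ) hc.mdifferentiableAt)
  have h3 := hasFDerivAt_idChart_lieExp (H := H) h2
  have h0 : (0 : E) = lieLog E (c 0) := by rw [hc0, lieLog_one h2]
  rw [h0] at h3
  have h4 := h3.comp_hasDerivAt (0 : ℝ) h1.hasDerivAt
  have h5 := ((hasMFDerivAt_curve_iff hc0 x).1 hc).2
  have h6 : (fun x : E => idChart E H (lieExp x)) ∘ (fun t => lieLog E (c t)) =
      fun s => extChartAt 𝓘(ℝ, E) 1 (c s) := by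
    funext s
    simp only [Function.comp_apply, lieExp_lieLog h2]
    rfl
  rw [h6] at h4
  have h7 := h4.unique h5
  exact h1.hasDerivAt.congr_deriv h7

end Log

/-! ### Automorphisms of the group and of the Lie algebra -/

section Automorphisms

variable {E : Type*} [NormedAddCommGroup E] [NormedSpace ℝ E]
  {H : Type*} [TopologicalSpace H] [ChartedSpace E H] [Group H] [LieGroup 𝓘(ℝ, E) ∞ H]

theorem lieAut_lieExp [CompleteSpace E] (α : LieAut E H) (x : E) :
    α.1 (lieExp x) = lieExp ((autDiff α : E →L[ℝ] E) x) :=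
  map_lieExp α.1.toMonoidHom α.2.1 x

variable [FiniteDimensional ℝ E] [CompleteSpace E]
  [SimplyConnectedSpace H] (h2 : ∀ x y z : E, lieBr E H x (lieBr E H y z) = 0)

include h2

theorem lieLog_lieAut (α : LieAut E H) (h : H) :
    lieLog E (α.1 h) = (autDiff α : E →L[ℝ] E) (lieLog E h) := by
  conv_lhs => rw [← lieExp_lieLog h2 h]
  rw [lieAut_lieExp, lieLog_lieExp h2]

/-- The exponential map being surjective, an automorphism is determined by its differential. -/
theorem autDiff_injective : Function.Injective (autDiff : LieAut E H → (E →L[ℝ] E)ˣ) := by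
  intro α β h
  apply Subtype.ext
  ext g
  rw [← lieExp_lieLog h2 g, lieAut_lieExp, lieAut_lieExp, h]

/-- The differential of an automorphism of the group is an automorphism of the Lie algebra. -/
theorem autDiff_lieBr (α : LieAut E H) (x y : E) :
    (autDiff α : E →L[ℝ] E) (lieBr E H x y) =
      lieBr E H ((autDiff α : E →L[ℝ] E) x) ((autDiff α : E →L[ℝ] E) y) := by
  have h1 := lieLog_lieAut h2 α (lieExp x * lieExp y)
  rw [map_mul, lieLog_mul h2, lieLog_mul h2, lieAut_lieExp, lieAut_lieExp] at h1
  simp only [lieLog_lieExp h2, map_add, map_smul] at h1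
  exact (smul_right_injective E (by norm_num : (1 / 2 : ℝ) ≠ 0) (add_left_cancel h1)).symm

/-- Every automorphism of the Lie algebra is the differential of an automorphism of the group. -/
theorem exists_autDiff_eq (A : (E →L[ℝ] E)ˣ)
    (hA : ∀ x y, (A : E →L[ℝ] E) (lieBr E H x y) =
      lieBr E H ((A : E →L[ℝ] E) x) ((A : E →L[ℝ] E) y)) :
    ∃ α : LieAut E H, autDiff α = A := by
  have hAi : ∀ x, (A : E →L[ℝ] E) (((A⁻¹ : (E →L[ℝ] E)ˣ) : E →L[ℝ] E) x) = x := fun x => by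
    rw [← mul_apply_eq_comp, Units.mul_inv]; rfl
  have hiA : ∀ x, ((A⁻¹ : (E →L[ℝ] E)ˣ) : E →L[ℝ] E) ((A : E →L[ℝ] E) x : E) = x := fun x => by
    rw [← mul_apply_eq_comp, Units.inv_mul]; rfl
  let e : MulAut H :=
    { toFun := fun h => lieExp ((A : E →L[ℝ] E) (lieLog E h))
      invFun := fun h => lieExp (((A⁻¹ : (E →L[ℝ] E)ˣ) : E →L[ℝ] E) (lieLog E h))
      left_inv := fun h => by
        beta_reduce
        rw [lieLog_lieExp h2, hiA, lieExp_lieLog h2]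
      right_inv := fun h => by
        beta_reduce
        rw [lieLog_lieExp h2, hAi, lieExp_lieLog h2]
      map_mul' := fun g h => by
        rw [lieExp_mul_lieExp h2, lieLog_mul h2, map_add, map_add, map_smul, hA] }
  have hs : ∀ B : E →L[ℝ] E,
      ContMDiff 𝓘(ℝ, E) 𝓘(ℝ, E) ∞ (fun h : H => (lieExp (B (lieLog E h)) : H)) := fun B =>
    (contMDiff_lieExp h2).comp (B.contDiff.contMDiff.comp (contMDiff_lieLog h2))
  refine ⟨⟨e, hs _, hs _⟩, ?_⟩
  ext x
  have h1 := lieAut_lieExp (⟨e, hs _, hs _⟩ : LieAut E H) x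
  refine (lieExp_bijective (H := H) h2).1 (h1.symm.trans ?_)
  change lieExp ((A : E →L[ℝ] E) (lieLog E (lieExp x : H))) = _
  rw [lieLog_lieExp h2]

end Automorphisms

/-! ### The morphism from affine transformations of the group to affine maps -/

theorem nilAff_smul_def {E : Type*} [NormedAddCommGroup E] [NormedSpace ℝ E]
    {H : Type*} [TopologicalSpace H] [ChartedSpace E H] [Group H] (a : NilAff E H) (n : H) :
    a • n = a.left * a.right.1 n := rfl

section Existence

variable {E : Type*} [NormedAddCommGroup E] [NormedSpace ℝ E]
  [FiniteDimensional ℝ E] [CompleteSpace E]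
  {H : Type*} [TopologicalSpace H] [ChartedSpace E H] [Group H] [LieGroup 𝓘(ℝ, E) ∞ H]
  [SimplyConnectedSpace H]

/-- The action of `a ∈ Aff(H)` on `H`, transported to the vector space `V` by the logarithm. It is
the affine map `v ↦ log m + A v + [log m, A v] / 2` for `a = (m, α)` and `A = dα`. -/
noncomputable def logConj (a : NilAff E H) : E →ᵃ[ℝ] E where
  toFun v := lieLog E a.left + ((autDiff a.right : E →L[ℝ] E) v +
    (1 / 2 : ℝ) • lieBr E H (lieLog E a.left) ((autDiff a.right : E →L[ℝ] E) v))
  linear := ((autDiff a.right : E →L[ℝ] E) +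
    (1 / 2 : ℝ) • (lieBr E H (lieLog E a.left) ∘L (autDiff a.right : E →L[ℝ] E)) : E →L[ℝ] E)
  map_vadd' v w := by
    simp
    abel

theorem logConj_apply (h2 : ∀ x y z : E, lieBr E H x (lieBr E H y z) = 0) (a : NilAff E H)
    (v : E) : logConj a v = lieLog E (a • (lieExp v : H)) := by
  rw [nilAff_smul_def, lieLog_mul h2, lieLog_lieAut h2, lieLog_lieExp h2]
  simp [logConj, add_assoc]

/-- Conjugation by the logarithm, as a homomorphism from `Aff(H)` to `Aff(V)`. -/
noncomputable def logConjHom (h2 : ∀ x y z : E, lieBr E H x (lieBr E H y z) = 0) :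
    NilAff E H →* (E ≃ᵃ[ℝ] E) :=
  AffineEquiv.equivUnitsAffineMap.symm.toMonoidHom.comp (MonoidHom.toHomUnits
    { toFun := logConj
      map_one' := by
        ext v
        rw [logConj_apply h2, one_smul, lieLog_lieExp h2]; rfl
      map_mul' := fun a b => by
        ext v
        rw [AffineMap.coe_mul, Function.comp_apply, logConj_apply h2, logConj_apply h2,
          logConj_apply h2, lieExp_lieLog h2, mul_smul] })

theorem logConjHom_apply (h2 : ∀ x y z : E, lieBr E H x (lieBr E H y z) = 0) (a : NilAff E H)
    (v : E) : logConjHom h2 a v = lieLog E (a • (lieExp v : H)) :=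
  logConj_apply h2 a v

theorem affCoord_logConjHom (h2 : ∀ x y z : E, lieBr E H x (lieBr E H y z) = 0)
    (a : NilAff E H) : affCoord (logConjHom h2 a) =
      (lieLog E a.left, (autDiff a.right : E →L[ℝ] E) +
        (1 / 2 : ℝ) • (lieBr E H (lieLog E a.left) ∘L (autDiff a.right : E →L[ℝ] E))) := by
  refine Prod.ext ?_ ?_
  · change logConj a 0 = _
    simp [logConj]
  · ext v; rfl

/-- The second component of the derivative comes from differentiating
`A + [log m, ·] ∘ A / 2` at `m = 1`, `A = 1`. -/
theorem integratesPsi_logConjHom (h2 : ∀ x y z : E, lieBr E H x (lieBr E H y z) = 0) :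
    IntegratesPsi ((logConjHom h2).comp (NilAffZero E H).subtype) where
  smooth := by
    intro a
    refine ⟨univ, isOpen_univ, mem_univ _, fun q => (lieLog E q.1, q.2 +
        (1 / 2 : ℝ) • (lieBr E H (lieLog E q.1) ∘L q.2)), ?_, fun b _ => affCoord_logConjHom h2 b.1⟩
    have h1 : ContDiff ℝ ∞ (fun q : E × (E →L[ℝ] E) => ((q.1, q.2 +
        (1 / 2 : ℝ) • (lieBr E H q.1 ∘L q.2)) : E × (E →L[ℝ] E))) :=
      contDiff_fst.prodMk (contDiff_snd.add ((((lieBr E H).contDiff.comp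
        contDiff_fst).clm_comp contDiff_snd).const_smul (1 / 2 : ℝ)))
    have h3 : ContMDiff (𝓘(ℝ, E).prod 𝓘(ℝ, E →L[ℝ] E)) 𝓘(ℝ, E × (E →L[ℝ] E)) ∞
        (fun q : H × (E →L[ℝ] E) => (lieLog E q.1, q.2)) :=
      ((contMDiff_lieLog h2).comp contMDiff_fst).prodMk_space contMDiff_snd
    exact (h1.contMDiff.comp h3).contMDiffOn
  deriv_eq := by
    rintro γ x D hγ ⟨hm, hA⟩
    have hm0 : (γ 0).1.left = 1 := by rw [hγ]; rfl
    have hA0 : (nilAffCoord (γ 0).1).2 = 1 := by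
      rw [hγ]
      change ((autDiff (1 : LieAut E H) : (E →L[ℝ] E)ˣ) : E →L[ℝ] E) = 1
      rw [map_one]; rfl
    have hl := hasDerivAt_lieLog (x := (x : E)) h2 hm0 hm
    have hB := (((lieBr E H).hasFDerivAt.comp_hasDerivAt (0 : ℝ) hl).clm_comp hA).const_smul
      (1 / 2 : ℝ)
    have h1 := hl.prodMk (hA.add hB)
    have h3 : HasDerivAt (fun t => affCoord (logConjHom h2 (γ t).1)) _ 0 :=
      h1.congr_of_eventuallyEq (Eventually.of_forall fun t => affCoord_logConjHom h2 (γ t).1)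
    refine h3.congr_deriv ?_
    refine Prod.ext rfl ?_
    ext v
    simp only [Function.comp_apply, hm0, lieLog_one h2, hA0]
    have h4 : LinearMap.toContinuousLinearMap (psi x D).2 v =
        (LinearMap.toContinuousLinearMap (D.toLinearMap : E →ₗ[ℝ] E) : E →L[ℝ] E) v +
          (1 / 2 : ℝ) • lieBr E H x v :=
      congrArg (fun w : E => (LinearMap.toContinuousLinearMap
        (D.toLinearMap : E →ₗ[ℝ] E) : E →L[ℝ] E) v + (1 / 2 : ℝ) • w) (lie_eq_lieBr x v)
    refine Eq.trans ?_ h4.symm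
    simp

end Existence

/-! ### One-parameter groups of affine maps -/

section AffineOneParameter

variable {E : Type*} [NormedAddCommGroup E] [NormedSpace ℝ E] [FiniteDimensional ℝ E]

theorem affCoord_injective : Function.Injective (affCoord : (E ≃ᵃ[ℝ] E) → E × (E →L[ℝ] E)) := by
  intro a b h
  have h1 : a 0 = b 0 := congrArg Prod.fst h
  have h3 := LinearMap.toContinuousLinearMap.injective (congrArg Prod.snd h)
  have h4 : ∀ c : E ≃ᵃ[ℝ] E, ∀ v, c v = c.linear v + c 0 := fun c v => by
    simpa using c.map_vadd 0 v
  ext v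
  rw [h4 a, h4 b, h1]
  exact congrArg (· + b 0) (LinearMap.congr_fun h3 v)

theorem affCoord_mul (a b : E ≃ᵃ[ℝ] E) : affCoord (a * b) =
    ((affCoord a).2 (affCoord b).1 + (affCoord a).1, (affCoord a).2 * (affCoord b).2) := by
  refine Prod.ext ?_ ?_
  · change a (b 0) = a.linear (b 0) + a 0
    simpa using a.map_vadd 0 (b 0)
  · ext v; rfl

/-- A one-parameter group of affine maps is determined by its velocity, since its coordinates
solve a linear differential equation. -/
theorem eq_of_hasAffVelocity {c d : ℝ → (E ≃ᵃ[ℝ] E)} {X : E × (E →ₗ[ℝ] E)}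
    (hc : ∀ s t, c (s + t) = c s * c t) (hd : ∀ s t, d (s + t) = d s * d t)
    (hcX : HasAffVelocity c X) (hdX : HasAffVelocity d X) : c = d := by
  let W : E × (E →L[ℝ] E) →L[ℝ] E × (E →L[ℝ] E) :=
    ((ContinuousLinearMap.apply ℝ E X.1).prod
      ((ContinuousLinearMap.mul ℝ (E →L[ℝ] E)).flip (LinearMap.toContinuousLinearMap X.2))) ∘L
        ContinuousLinearMap.snd ℝ E (E →L[ℝ] E)
  have key : ∀ c : ℝ → (E ≃ᵃ[ℝ] E), (∀ s t, c (s + t) = c s * c t) → HasAffVelocity c X →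
      ∀ t, HasDerivAt (fun s => affCoord (c s)) (W (affCoord (c t))) t := by
    intro c hc hX t
    let T : E × (E →L[ℝ] E) →L[ℝ] E × (E →L[ℝ] E) :=
      ((affCoord (c t)).2.prodMap (ContinuousLinearMap.mul ℝ (E →L[ℝ] E) (affCoord (c t)).2))
    have h1 : HasDerivAt (fun s => T (affCoord (c s)) + ((affCoord (c t)).1, 0))
        (T (X.1, LinearMap.toContinuousLinearMap X.2)) (t + -t) := by
      rw [add_neg_cancel]
      exact (T.hasFDerivAt.comp_hasDerivAt (0 : ℝ) hX).add_const _
    have h3 := h1.comp_add_const t (-t)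
    refine (h3.congr_of_eventuallyEq (Eventually.of_forall fun s => ?_))
    have h4 : c s = c t * c (s + -t) := by rw [← hc]; congr 1; ring
    change affCoord (c s) = _
    rw [h4, affCoord_mul]
    refine Prod.ext rfl ?_
    simp [T]
  have h0 : ∀ c : ℝ → (E ≃ᵃ[ℝ] E), (∀ s t, c (s + t) = c s * c t) → c 0 = 1 := fun c hc => by
    simpa using hc 0 0
  have h1 : (fun s => affCoord (c s)) = fun s => affCoord (d s) :=
    ODE_solution_unique_univ (v := fun _ => W) (s := fun _ => univ) (K := ‖W‖₊) (t₀ := 0)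
      (fun _ => W.lipschitz.lipschitzOnWith) (fun t => ⟨key c hc hcX t, mem_univ _⟩)
      (fun t => ⟨key d hd hdX t, mem_univ _⟩) (by rw [h0 c hc, h0 d hd])
  funext t
  exact affCoord_injective (congrFun h1 t)

end AffineOneParameter

/-! ### Automorphisms near the identity are exponentials of derivations -/

section Derivations

variable {E : Type*} [NormedAddCommGroup E] [NormedSpace ℝ E]

/-- The failure of `L` to be a derivation of the bilinear map `β`. -/
noncomputable def derivDefect (β : E →L[ℝ] E →L[ℝ] E) (L : E →L[ℝ] E) : E →L[ℝ] E →L[ℝ] E :=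
  β ∘L L + (β.flip ∘L L).flip - (ContinuousLinearMap.compL ℝ E E E L) ∘L β

theorem derivDefect_apply (β : E →L[ℝ] E →L[ℝ] E) (L : E →L[ℝ] E) (x y : E) :
    derivDefect β L x y = β (L x) y + β x (L y) - L (β x y) := by
  simp [derivDefect]

/-- Transporting a bilinear map by maps close to the identity changes it by less than its norm. -/
theorem norm_transport_sub_le {w : E →L[ℝ] E →L[ℝ] E} {P Q : E →L[ℝ] E}
    (hP : ‖P - 1‖ ≤ 1 / 8) (hQ : ‖Q - 1‖ ≤ 1 / 8) (x y : E) :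
    ‖P (w (Q x) (Q y)) - w x y‖ ≤ 1 / 2 * ‖w‖ * ‖x‖ * ‖y‖ := by
  have hR : ∀ R : E →L[ℝ] E, ‖R - 1‖ ≤ 1 / 8 → ∀ z, ‖R z - z‖ ≤ 1 / 8 * ‖z‖ := fun R hR z =>
    (R - 1).le_of_opNorm_le hR z
  have hQ' : ∀ z, ‖Q z‖ ≤ 9 / 8 * ‖z‖ := fun z => by
    have h1 := norm_le_norm_add_norm_sub' (Q z) z
    have h3 := hR Q hQ z
    linarith
  have e : P (w (Q x) (Q y)) - w x y = (P (w (Q x) (Q y)) - w (Q x) (Q y)) +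
      w (Q x - x) (Q y) + w x (Q y - y) := by
    simp only [map_sub, sub_apply]; abel
  have h1 : ‖w (Q x) (Q y)‖ ≤ ‖w‖ * (9 / 8 * ‖x‖) * (9 / 8 * ‖y‖) :=
    (w.le_opNorm₂ _ _).trans (by gcongr <;> apply hQ')
  have h3 : ‖w (Q x - x) (Q y)‖ ≤ ‖w‖ * (1 / 8 * ‖x‖) * (9 / 8 * ‖y‖) :=
    (w.le_opNorm₂ _ _).trans (by gcongr; exacts [hR Q hQ x, hQ' y])
  have h4 : ‖w x (Q y - y)‖ ≤ ‖w‖ * ‖x‖ * (1 / 8 * ‖y‖) :=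
    (w.le_opNorm₂ _ _).trans (by gcongr; exact hR Q hQ y)
  have h5 := hR P hP (w (Q x) (Q y))
  have h6 := norm_add₃_le (a := P (w (Q x) (Q y)) - w (Q x) (Q y)) (b := w (Q x - x) (Q y))
    (c := w x (Q y - y))
  rw [e]
  have h7 : 0 ≤ ‖w‖ * ‖x‖ * ‖y‖ := by positivity
  nlinarith

variable [CompleteSpace E]

theorem exp_add_smul (L : E →L[ℝ] E) (s t : ℝ) : NormedSpace.exp ((s + t) • L) =
    NormedSpace.exp (s • L) * NormedSpace.exp (t • L) := by
  let _ : NormedAlgebra ℚ (E →L[ℝ] E) := .restrictScalars ℚ ℝ (E →L[ℝ] E)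
  rw [add_smul, NormedSpace.exp_add_of_commute]
  exact ((Commute.refl L).smul_left s).smul_right t

theorem exp_neg_smul_apply_exp_smul_apply (L : E →L[ℝ] E) (t : ℝ) (x : E) :
    NormedSpace.exp ((-t) • L) (NormedSpace.exp (t • L) x) = x := by
  rw [← mul_apply_eq_comp, ← exp_add_smul, neg_add_cancel, zero_smul, NormedSpace.exp_zero]
  rfl

theorem exp_smul_apply_exp_neg_smul_apply (L : E →L[ℝ] E) (t : ℝ) (x : E) :
    NormedSpace.exp (t • L) (NormedSpace.exp ((-t) • L) x) = x := by
  rw [← mul_apply_eq_comp, ← exp_add_smul, add_neg_cancel, zero_smul, NormedSpace.exp_zero]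
  rfl

/-- The derivative of the transported bilinear map `e^{-tL} β(e^{tL} x, e^{tL} y)` is the transport
of the defect of `L`. -/
theorem hasDerivAt_transport (β : E →L[ℝ] E →L[ℝ] E) (L : E →L[ℝ] E) (x y : E) (t : ℝ) :
    HasDerivAt (fun t : ℝ => NormedSpace.exp ((-t) • L)
        (β (NormedSpace.exp (t • L) x) (NormedSpace.exp (t • L) y)))
      (NormedSpace.exp ((-t) • L)
        (derivDefect β L (NormedSpace.exp (t • L) x) (NormedSpace.exp (t • L) y))) t := by
  have h1 : ∀ z : E, HasDerivAt (fun t : ℝ => NormedSpace.exp (t • L) z)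
      (L (NormedSpace.exp (t • L) z)) t := fun z =>
    (ContinuousLinearMap.apply ℝ E z).hasFDerivAt.comp_hasDerivAt t
      (hasDerivAt_exp_smul_const' L t)
  have h3 : HasDerivAt (fun t : ℝ => NormedSpace.exp ((-t) • L))
      (-(NormedSpace.exp ((-t) • L) * L)) t := by
    have h := (hasDerivAt_exp_smul_const L (-t)).scomp t (hasDerivAt_neg t)
    rwa [neg_one_smul] at h
  have h4 := (β.hasFDerivAt.comp_hasDerivAt t (h1 x)).clm_apply (h1 y)
  refine (h3.clm_apply h4).congr_deriv ?_
  simp only [derivDefect_apply, map_sub, map_add, Function.comp_apply,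
    neg_apply, mul_apply_eq_comp]
  abel

/-- The exponential of a derivation is an automorphism. -/
theorem exp_smul_map_of_derivDefect_eq_zero {β : E →L[ℝ] E →L[ℝ] E} {L : E →L[ℝ] E}
    (h : derivDefect β L = 0) (t : ℝ) (x y : E) : NormedSpace.exp (t • L) (β x y) =
      β (NormedSpace.exp (t • L) x) (NormedSpace.exp (t • L) y) := by
  have h1 := is_const_of_deriv_eq_zero (𝕜 := ℝ)
    (fun s => (hasDerivAt_transport β L x y s).differentiableAt)
    (fun s => by rw [(hasDerivAt_transport β L x y s).deriv, h]; simp) t 0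
  simp only [neg_zero, zero_smul, NormedSpace.exp_zero, one_apply_eq_self] at h1
  rw [← h1, exp_smul_apply_exp_neg_smul_apply]

/-- An automorphism of a bilinear map that is close to the identity is the exponential of a
derivation. -/
theorem eventually_exists_exp_eq (β : E →L[ℝ] E →L[ℝ] E) : ∀ᶠ A in 𝓝 (1 : E →L[ℝ] E),
    (∀ x y, A (β x y) = β (A x) (A y)) →
      ∃ L : E →L[ℝ] E, NormedSpace.exp L = A ∧ derivDefect β L = 0 := by
  have hmap : map NormedSpace.exp (𝓝 (0 : E →L[ℝ] E)) = 𝓝 1 := by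
    have h := HasStrictFDerivAt.map_nhds_eq_of_equiv
      (f' := ContinuousLinearEquiv.refl ℝ (E →L[ℝ] E)) (f := NormedSpace.exp) (a := 0)
      (hasStrictFDerivAt_exp_zero (𝕂 := ℝ))
    rwa [NormedSpace.exp_zero] at h
  have hcont : ∀ᶠ L in 𝓝 (0 : E →L[ℝ] E), ‖NormedSpace.exp L - 1‖ ≤ 1 / 8 := by
    have h : Tendsto NormedSpace.exp (𝓝 (0 : E →L[ℝ] E)) (𝓝 1) := hmap.le
    have h1 := h.eventually (Metric.closedBall_mem_nhds (1 : E →L[ℝ] E) (by norm_num : (0:ℝ) < 1/8))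
    filter_upwards [h1] with L hL
    rwa [← dist_eq_norm]
  obtain ⟨r, hr, hball⟩ := Metric.eventually_nhds_iff_ball.1 hcont
  rw [← hmap, eventually_map]
  filter_upwards [Metric.ball_mem_nhds (0 : E →L[ℝ] E) hr] with L hL hA
  refine ⟨L, rfl, ?_⟩
  have hsmall : ∀ t : ℝ, |t| ≤ 1 → ‖NormedSpace.exp (t • L) - 1‖ ≤ 1 / 8 := fun t ht => by
    refine hball _ ?_
    rw [mem_ball_zero_iff] at hL ⊢
    rw [norm_smul, Real.norm_eq_abs]
    exact (mul_le_of_le_one_left (norm_nonneg _) ht).trans_lt hL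
  -- The transported map returns to `β` at time `1`, so that its velocity has mean zero. The
  -- velocity stays within half of the norm of the defect from the defect, and so does its mean.
  have hw : ‖derivDefect β L‖ ≤ 1 / 2 * ‖derivDefect β L‖ := by
    refine ContinuousLinearMap.opNorm_le_bound₂ _ (by positivity) fun x y => ?_
    have h1 := norm_image_sub_le_of_norm_deriv_le_segment_01'
      (fun t _ => ((hasDerivAt_transport β L x y t).sub
        ((hasDerivAt_id t).smul_const (derivDefect β L x y))).hasDerivWithinAt)
      (C := 1 / 2 * ‖derivDefect β L‖ * ‖x‖ * ‖y‖) (fun t ht => by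
        rw [one_smul]
        exact norm_transport_sub_le (hsmall _ (by rw [abs_neg, abs_of_nonneg ht.1]; exact ht.2.le))
          (hsmall _ (by rw [abs_of_nonneg ht.1]; exact ht.2.le)) x y)
    have h3 : NormedSpace.exp (-L) (β (NormedSpace.exp L x) (NormedSpace.exp L y)) =
        β x y := by
      rw [← hA]
      simpa using exp_neg_smul_apply_exp_smul_apply L 1 (β x y)
    simpa [h3] using h1
  have h0 := norm_nonneg (derivDefect β L)
  have h1 : ‖derivDefect β L‖ = 0 := by linarith
  exact (ContinuousLinearMap.opNorm_zero_iff _).1 h1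

end Derivations

/-! ### Uniqueness of the morphism -/

section

variable {E : Type*} [NormedAddCommGroup E] [NormedSpace ℝ E]
  {H : Type*} [TopologicalSpace H] [ChartedSpace E H] [Group H] [ConnectedSpace H]

theorem inr_mem_nilAffZero {α : LieAut E H} (hα : α ∈ connectedComponent (1 : LieAut E H)) :
    (SemidirectProduct.inr α : NilAff E H) ∈ NilAffZero E H := by
  change _ ∈ connectedComponent (1 : NilAff E H)
  rwa [connectedComponent_nilAff]

end

section Uniqueness

variable {E : Type*} [NormedAddCommGroup E] [NormedSpace ℝ E]
  [FiniteDimensional ℝ E] [CompleteSpace E]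
  {H : Type*} [TopologicalSpace H] [ChartedSpace E H] [Group H] [LieGroup 𝓘(ℝ, E) ∞ H]
  [SimplyConnectedSpace H]

/-- Two integrations of `ψ` agree on one-parameter subgroups. -/
theorem IntegratesPsi.eq_of_hasNilAffVelocity {Ψ₁ Ψ₂ : NilAffZero E H →* (E ≃ᵃ[ℝ] E)}
    (h₁ : IntegratesPsi Ψ₁) (h₂ : IntegratesPsi Ψ₂) {γ : ℝ → NilAffZero E H}
    (hγ : ∀ s t, γ (s + t) = γ s * γ t) {x : GroupLieAlgebra 𝓘(ℝ, E) H}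
    {D : LieDerivation ℝ (GroupLieAlgebra 𝓘(ℝ, E) H) (GroupLieAlgebra 𝓘(ℝ, E) H)}
    (hv : HasNilAffVelocity γ x D) (t : ℝ) : Ψ₁ (γ t) = Ψ₂ (γ t) := by
  have h0 : γ 0 = 1 := by simpa using hγ 0 0
  exact congrFun (eq_of_hasAffVelocity (fun s t => by rw [hγ, map_mul])
    (fun s t => by rw [hγ, map_mul]) (h₁.deriv_eq γ x D h0 hv) (h₂.deriv_eq γ x D h0 hv)) t

theorem IntegratesPsi.eq_on_translations {Ψ₁ Ψ₂ : NilAffZero E H →* (E ≃ᵃ[ℝ] E)}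
    (h₁ : IntegratesPsi Ψ₁) (h₂ : IntegratesPsi Ψ₂)
    (h2 : ∀ x y z : E, lieBr E H x (lieBr E H y z) = 0) (h : H) :
    Ψ₁ ⟨SemidirectProduct.inl h, inl_mem_nilAffZero h⟩ =
      Ψ₂ ⟨SemidirectProduct.inl h, inl_mem_nilAffZero h⟩ := by
  obtain ⟨x, rfl⟩ := (lieExp_bijective h2).2 h
  have hx := isOneParam_lieExp (H := H) x
  have key := h₁.eq_of_hasNilAffVelocity h₂
    (γ := fun t => ⟨SemidirectProduct.inl (lieExp (t • x)), inl_mem_nilAffZero _⟩) (x := x) (D := 0)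
    (fun s t => Subtype.ext ((congrArg _ (hx.map_add s t)).trans (map_mul _ _ _)))
    ⟨hx.deriv, by
      refine (hasDerivAt_const (0 : ℝ) (1 : E →L[ℝ] E)).congr_of_eventuallyEq
        (Eventually.of_forall fun t => ?_) |>.congr_deriv ?_
      · change ((autDiff (1 : LieAut E H) : (E →L[ℝ] E)ˣ) : E →L[ℝ] E) = 1
        rw [map_one]; rfl
      · ext v; rfl⟩ 1
  simpa only [one_smul] using key

/-- The one-parameter group of automorphisms generated by a derivation of the Lie algebra. -/
theorem exists_lieAut_exp (h2 : ∀ x y z : E, lieBr E H x (lieBr E H y z) = 0)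
    {L : E →L[ℝ] E} (hL : derivDefect (lieBr E H) L = 0) :
    ∃ α : ℝ → LieAut E H, (∀ s t, α (s + t) = α s * α t) ∧
      (∀ t, (autDiff (α t) : E →L[ℝ] E) = NormedSpace.exp (t • L)) ∧
      ∀ t, α t ∈ connectedComponent (1 : LieAut E H) := by
  let u : ℝ → (E →L[ℝ] E)ˣ := fun t =>
    ⟨NormedSpace.exp (t • L), NormedSpace.exp ((-t) • L),
      ContinuousLinearMap.ext (exp_smul_apply_exp_neg_smul_apply L t),
      ContinuousLinearMap.ext (exp_neg_smul_apply_exp_smul_apply L t)⟩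
  choose α hα using fun t => exists_autDiff_eq h2 (u t) (exp_smul_map_of_derivDefect_eq_zero hL t)
  have hadd : ∀ s t, α (s + t) = α s * α t := fun s t => by
    apply autDiff_injective h2
    rw [map_mul, hα, hα, hα]
    exact Units.ext (exp_add_smul L s t)
  refine ⟨α, hadd, fun t => by rw [hα], fun t => ?_⟩
  have hexp : Continuous fun t : ℝ => NormedSpace.exp (t • L) :=
    (differentiable_exp_smul_const (𝕂 := ℝ) L).continuous
  have hcont : Continuous α := by
    refine continuous_induced_rng.2 ?_
    have hu : (autDiff ∘ α) = u := funext hα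
    rw [hu]
    exact Units.continuous_iff.2 ⟨hexp, hexp.comp continuous_neg⟩
  have h0 : α 0 = 1 := by simpa using hadd 0 0
  exact (isPreconnected_range hcont).subset_connectedComponent ⟨0, h0⟩ ⟨t, rfl⟩

/-- Two integrations of `ψ` agree on the automorphisms close to the identity, hence on the subgroup
that these generate, which contains the identity component. -/
theorem IntegratesPsi.eq_on_automorphisms {Ψ₁ Ψ₂ : NilAffZero E H →* (E ≃ᵃ[ℝ] E)}
    (h₁ : IntegratesPsi Ψ₁) (h₂ : IntegratesPsi Ψ₂)
    (h2 : ∀ x y z : E, lieBr E H x (lieBr E H y z) = 0) {α : LieAut E H}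
    (hα : α ∈ connectedComponent (1 : LieAut E H)) :
    Ψ₁ ⟨SemidirectProduct.inr α, inr_mem_nilAffZero hα⟩ =
      Ψ₂ ⟨SemidirectProduct.inr α, inr_mem_nilAffZero hα⟩ := by
  -- The automorphisms in `Aff⁰(H)` on which the two morphisms agree.
  let S : Subgroup (LieAut E H) :=
    ((Ψ₁.eqLocus Ψ₂).map (NilAffZero E H).subtype).comap SemidirectProduct.inr
  have hS : (S : Set (LieAut E H)) ∈ 𝓝 1 := by
    have hc : Continuous fun α : LieAut E H => (autDiff α : E →L[ℝ] E) :=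
      Units.continuous_val.comp continuous_induced_dom
    have hc1 : Tendsto (fun α : LieAut E H => (autDiff α : E →L[ℝ] E)) (𝓝 1) (𝓝 1) := by
      have h := hc.tendsto 1
      rwa [map_one, Units.val_one] at h
    filter_upwards [hc1.eventually (eventually_exists_exp_eq (lieBr E H))] with β hβ
    obtain ⟨L, hLβ, hL⟩ := hβ (autDiff_lieBr h2 β)
    obtain ⟨a, hadd, ha, hmem⟩ := exists_lieAut_exp h2 hL
    have h1 : a 1 = β := by
      apply autDiff_injective h2
      ext1
      rw [ha, one_smul, hLβ]
    have hleib : ∀ x y : E,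
        L (lieBr E H x y) = lieBr E H x (L y) - lieBr E H y (L x) := fun x y => by
      have h3 := derivDefect_apply (lieBr E H) L x y
      rw [hL, zero_apply, zero_apply] at h3
      rw [← sub_eq_zero.1 h3.symm, lieBr_swap y]
      abel
    let D : LieDerivation ℝ (GroupLieAlgebra 𝓘(ℝ, E) H) (GroupLieAlgebra 𝓘(ℝ, E) H) :=
      { toLinearMap := (L : E →ₗ[ℝ] E)
        leibniz' := fun x y => by
          exact (congrArg L (lie_eq_lieBr x y)).trans ((hleib x y).trans
            (congrArg₂ (fun v w : E => v - w)
              (lie_eq_lieBr x (L y)) (lie_eq_lieBr y (L x))).symm) }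
    have key := h₁.eq_of_hasNilAffVelocity h₂
      (γ := fun t => ⟨SemidirectProduct.inr (a t), inr_mem_nilAffZero (hmem t)⟩) (x := 0) (D := D)
      (fun s t => Subtype.ext ((congrArg _ (hadd s t)).trans
        (map_mul (SemidirectProduct.inr : LieAut E H →* NilAff E H) _ _)))
      ⟨by
        have h3 : HasMFDerivAt 𝓘(ℝ, ℝ) 𝓘(ℝ, E) (fun _ : ℝ => (1 : H)) 0 (0 : ℝ →L[ℝ] E) :=
          hasMFDerivAt_const _ _
        rwa [← ContinuousLinearMap.toSpanSingleton_zero] at h3, by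
        have h3 := hasDerivAt_exp_smul_const L (0 : ℝ)
        rw [zero_smul, NormedSpace.exp_zero, one_mul] at h3
        exact (h3.congr_of_eventuallyEq (Eventually.of_forall ha)).congr_deriv
          (ContinuousLinearMap.ext fun v => rfl)⟩ 1
    exact ⟨⟨SemidirectProduct.inr (a 1), inr_mem_nilAffZero (hmem 1)⟩, key,
      congrArg SemidirectProduct.inr h1⟩
  have hopen := S.isOpen_of_mem_nhds hS
  obtain ⟨b, hb, hbα⟩ := IsClopen.connectedComponent_subset ⟨S.isClosed_of_isOpen hopen, hopen⟩
    S.one_mem hα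
  have hb' : b = ⟨SemidirectProduct.inr α, inr_mem_nilAffZero hα⟩ := Subtype.ext hbα
  rw [← hb']
  exact hb

theorem IntegratesPsi.unique {Ψ₁ Ψ₂ : NilAffZero E H →* (E ≃ᵃ[ℝ] E)}
    (h₁ : IntegratesPsi Ψ₁) (h₂ : IntegratesPsi Ψ₂)
    (h2 : ∀ x y z : E, lieBr E H x (lieBr E H y z) = 0) : Ψ₁ = Ψ₂ := by
  ext1 a
  have ha : a.1.right ∈ connectedComponent (1 : LieAut E H) := by
    have h := a.2
    change _ ∈ connectedComponent (1 : NilAff E H) at h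
    rwa [connectedComponent_nilAff] at h
  have hfac : a = ⟨SemidirectProduct.inl a.1.left, inl_mem_nilAffZero _⟩ *
      ⟨SemidirectProduct.inr a.1.right, inr_mem_nilAffZero ha⟩ :=
    Subtype.ext (SemidirectProduct.inl_left_mul_inr_right a.1).symm
  rw [hfac, map_mul, map_mul, h₁.eq_on_translations h₂ h2, h₁.eq_on_automorphisms h₂ h2 ha]

end Uniqueness

/-! ### Representations and simply transitive actions -/

section Representations

variable {E : Type*} [NormedAddCommGroup E] [NormedSpace ℝ E]
  {H : Type*} [TopologicalSpace H] [ChartedSpace E H] [Group H]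
  {F : Type*} [NormedAddCommGroup F] [NormedSpace ℝ F]
  {G : Type*} [TopologicalSpace G] [ChartedSpace F G] [Group G] [LieGroup 𝓘(ℝ, F) ∞ G]

theorem IsSmoothRep.continuous {ρ : G →* NilAff E H} (hρ : IsSmoothRep (F := F) ρ) :
    Continuous ρ := by
  have : IsTopologicalGroup G := topologicalGroup_of_lieGroup 𝓘(ℝ, F) ∞
  have hc : Continuous fun g => nilAffCoord (ρ g) := ContMDiff.continuous hρ
  have hr : Continuous fun g => (autDiff (ρ g).right : E →L[ℝ] E) := continuous_snd.comp hc
  -- The topology of `GL(V)` also involves the inverse, which is controlled by `ρ g⁻¹`.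
  refine continuous_induced_rng.2 ((continuous_fst.comp hc).prodMk
    (continuous_induced_rng.2 (Units.continuous_iff.2 ⟨hr, ?_⟩)))
  refine (hr.comp continuous_inv).congr fun g => ?_
  simp only [Function.comp_apply, map_inv]
  rfl

theorem IsSmoothRep.mem_nilAffZero [ConnectedSpace H] [ConnectedSpace G] {ρ : G →* NilAff E H}
    (hρ : IsSmoothRep (F := F) ρ) (g : G) : ρ g ∈ NilAffZero E H :=
  (isPreconnected_range hρ.continuous).subset_connectedComponent ⟨1, map_one ρ⟩ ⟨g, rfl⟩

theorem isSimplyTransitive_iff_of_equiv {G X Y : Type*} {act : G → X → X} {act' : G → Y → Y}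
    (e : Y ≃ X) (h : ∀ g y, act g (e y) = e (act' g y)) :
    IsSimplyTransitive act ↔ IsSimplyTransitive act' := by
  unfold IsSimplyTransitive
  rw [← e.forall_congr_right]
  refine forall_congr' fun x => ?_
  rw [← e.forall_congr_right]
  simp only [h, e.injective.eq_iff]

end Representations

theorem mainTheorem3
    {E : Type*} [NormedAddCommGroup E] [NormedSpace ℝ E] [FiniteDimensional ℝ E]
    {H : Type*} [TopologicalSpace H] [ChartedSpace E H] [Group H] [LieGroup 𝓘(ℝ, E) ∞ H]
    [SimplyConnectedSpace H]
    (hH : ∀ x y z : GroupLieAlgebra 𝓘(ℝ, E) H, ⁅x, ⁅y, z⁆⁆ = 0)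
    {F : Type*} [NormedAddCommGroup F] [NormedSpace ℝ F] [FiniteDimensional ℝ F]
    {G : Type*} [TopologicalSpace G] [ChartedSpace F G] [Group G] [LieGroup 𝓘(ℝ, F) ∞ G]
    [ConnectedSpace G]
    (ρ : G →* NilAff E H) (hρ : IsSmoothRep (F := F) ρ) :
    (∃! Ψ : NilAffZero E H →* (E ≃ᵃ[ℝ] E), IntegratesPsi Ψ) ∧
    (∀ h : H, ∃! x : GroupLieAlgebra 𝓘(ℝ, E) H, IsLieExp x h) ∧
    ∀ Ψ : NilAffZero E H →* (E ≃ᵃ[ℝ] E), IntegratesPsi Ψ →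
      (∀ (x : GroupLieAlgebra 𝓘(ℝ, E) H) (h : H), IsLieExp x h →
        ∀ v : GroupLieAlgebra 𝓘(ℝ, E) H,
          Ψ ⟨SemidirectProduct.inl h, inl_mem_nilAffZero h⟩ v = x + (v + (1 / 2 : ℝ) • ⁅x, v⁆)) ∧
      ∃ hρ₀ : ∀ g : G, ρ g ∈ NilAffZero E H,
        (IsSimplyTransitive (fun (g : G) (n : H) => ρ g • n) ↔
          IsSimplyTransitive (fun (g : G) (v : E) => Ψ ⟨ρ g, hρ₀ g⟩ v)) := by
  have : CompleteSpace E := FiniteDimensional.complete ℝ E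
  have h2 : ∀ x y z : E, lieBr E H x (lieBr E H y z) = 0 := fun x y z =>
    (congrArg (lieBr E H x) (lie_eq_lieBr y z)).symm.trans
      ((lie_eq_lieBr x _).symm.trans (hH x y z))
  have hΨ₀ := integratesPsi_logConjHom (H := H) h2
  refine ⟨⟨_, hΨ₀, fun Ψ hΨ => hΨ.unique hΨ₀ h2⟩, fun h => ?_, fun Ψ hΨ => ?_⟩
  · obtain ⟨x, hx⟩ := (lieExp_bijective h2).2 h
    refine ⟨x, (isLieExp_iff x h).2 hx, fun y hy => ?_⟩
    exact (lieExp_bijective h2).1 (((isLieExp_iff y h).1 hy).trans hx.symm)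
  obtain rfl := hΨ.unique hΨ₀ h2
  refine ⟨fun x h hx v => ?_, fun g => hρ.mem_nilAffZero g, ?_⟩
  · have h1 : ∀ x v w : E, lieExp x = h → w = lieBr E H x v →
        lieLog E (h * lieExp v) = x + (v + (1 / 2 : ℝ) • w) := by
      rintro x v _ rfl rfl
      rw [lieLog_mul h2, lieLog_lieExp h2, lieLog_lieExp h2, add_assoc]
    exact (logConjHom_apply h2 _ _).trans
      (h1 x v _ ((isLieExp_iff x h).1 hx) (lie_eq_lieBr x v))
  · refine isSimplyTransitive_iff_of_equiv (Equiv.ofBijective lieExp (lieExp_bijective h2))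
      fun g v => ?_
    exact (lieExp_lieLog h2 _).symm.trans (congrArg lieExp (logConjHom_apply h2 (ρ g) v).symm)
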